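/- Let $n\ge 2$ and $1<p<\infty$. Let $F:\mathbb{R}^n\to[0,\infty)$ be a convex function such that $F(t\xi)=|t|F(\xi)$ for all $t\in\mathbb{R}$, $\xi\in\mathbb{R}^n$, and $F(\xi)\ge a|\xi|$ for all $\xi$ and some constant $a>0$; assume that $F\in C^2(\mathbb{R}^n\setminus\{0\})$ and that the Hessian of $F^p$ is positive definite at every point of $\mathbb{R}^n\setminus\{0\}$. Let $F^o(v)=\sup_{\xi\ne0}\langle\xi,v\rangle/F(\xi)$. For a nonempty bounded open convex set $\Omega\subset\mathbb{R}^n$, with outward unit normal $\nu_{\partial\Omega}$ (defined $\mathcal{H}^{n-1}$-almost everywhere on $\partial\Omega$) and Lebesgue measure $V(\Omega)$, put $$\mathcal{F}(\Omega)=\frac{\displaystyle\int_{\partial\Omega}[F^o(x)]^p\,F(\nu_{\partial\Omega}(x))\,d\mathcal{H}^{n-1}(x)}{\left(\displaystyle\int_{\partial\Omega}F(\nu_{\partial\Omega}(x))\,d\mathcal{H}^{n-1}(x)\right)V(\Omega)^{p/n}}.$$ Then $\mathcal{F}$ attains its minimum over nonempty bounded open convex sets: there is a nonempty bounded open convex set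 $\Omega\subset\mathbb{R}^n$ such that $\mathcal{F}(\Omega)\le\mathcal{F}(\Omega')$ for every nonempty bounded open convex set $\Omega'\subset\mathbb{R}^n$. -/

import Mathlib

open MeasureTheory Set

noncomputable section

namespace AnisotropicMomentum

/-- `ℝⁿ` with its Euclidean norm, inner product and Lebesgue measure. -/
abbrev E (n : ℕ) : Type := EuclideanSpace ℝ (Fin n)

/-- `F` is a Finsler norm on `ℝⁿ`, elliptic with respect to the exponent `p`: a nonnegative convex
function, absolutely homogeneous of degree one, bounded below by a positive multiple of the
Euclidean norm, of class `C²` away from the origin, and such that the Hessian of `F ^ p` is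
positive definite away from the origin. -/
structure IsFinslerNorm (n : ℕ) (p : ℝ) (F : E n → ℝ) : Prop where
  nonneg : ∀ ξ, 0 ≤ F ξ
  convex : ConvexOn ℝ univ F
  homogeneous : ∀ (t : ℝ) (ξ : E n), F (t • ξ) = |t| * F ξ
  lower_bound : ∃ a : ℝ, 0 < a ∧ ∀ ξ, a * ‖ξ‖ ≤ F ξ
  contDiffOn : ContDiffOn ℝ 2 F {0}ᶜ
  hessian_pos : ∀ ξ : E n, ξ ≠ 0 → ∀ v : E n, v ≠ 0 →
    0 < fderiv ℝ (fderiv ℝ (fun η => F η ^ p)) ξ v v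

/-- The polar (dual) norm `F°(v) = sup_{ξ ≠ 0} ⟨ξ, v⟩ / F(ξ)`. -/
def polar {n : ℕ} (F : E n → ℝ) (v : E n) : ℝ :=
  ⨆ ξ : {ξ : E n // ξ ≠ 0}, inner ℝ (ξ : E n) v / F ξ

/-- `ν` is an outward unit normal to the convex set `Ω` at `x`: a unit vector such that `Ω` lies in
the half-space `{y | ⟨y - x, ν⟩ ≤ 0}`. -/
def IsOuterUnitNormal {n : ℕ} (Ω : Set (E n)) (x ν : E n) : Prop :=
  ‖ν‖ = 1 ∧ ∀ y ∈ Ω, inner ℝ (y - x) ν ≤ 0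

open Classical in
/-- The outward unit normal `ν_{∂Ω}(x)` of a convex set `Ω` at a boundary point `x`, where it is
unique. For a bounded open convex set this is the case for almost every boundary point with respect
to the `(n-1)`-dimensional Hausdorff measure; at the other points the value is set to be `0`. -/
def outerNormal {n : ℕ} (Ω : Set (E n)) (x : E n) : E n :=
  if h : ∃! ν, IsOuterUnitNormal Ω x ν then h.choose else 0

/-- The anisotropic perimeter `P_F(Ω) = ∫_{∂Ω} F(ν) dℋⁿ⁻¹` of a convex set. -/
def perimeter {n : ℕ} (F : E n → ℝ) (Ω : Set (E n)) : ℝ :=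
  ∫ x in frontier Ω, F (outerNormal Ω x) ∂μHE[n - 1]

/-- The anisotropic boundary `p`-momentum `M_F(Ω) = ∫_{∂Ω} F°(x)^p F(ν) dℋⁿ⁻¹` of a convex set. -/
def momentum {n : ℕ} (p : ℝ) (F : E n → ℝ) (Ω : Set (E n)) : ℝ :=
  ∫ x in frontier Ω, polar F x ^ p * F (outerNormal Ω x) ∂μHE[n - 1]

/-- The scale invariant functional `𝓕(Ω) = M_F(Ω) / (P_F(Ω) V(Ω)^{p/n})`. -/
def functional {n : ℕ} (p : ℝ) (F : E n → ℝ) (Ω : Set (E n)) : ℝ :=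
  momentum p F Ω / (perimeter F Ω * volume.real Ω ^ (p / (n : ℝ)))

/-- The competitors: nonempty bounded open convex subsets of `ℝⁿ`. -/
def admissible (n : ℕ) : Set (Set (E n)) :=
  {Ω | Ω.Nonempty ∧ Bornology.IsBounded Ω ∧ IsOpen Ω ∧ Convex ℝ Ω}

end AnisotropicMomentum

end

/-! The direct method. The functional is invariant under dilations about the origin, so each member
of a minimizing sequence may be rescaled to lie in the closed unit ball and to contain a point of
norm at least 1/2. What must be excluded is collapse to a set of zero volume, and what must be
supplied is continuity of the boundary integrals.

No collapse: if a convex set contains `q`, a dimensional fraction of its boundary measure lies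
outside the ball of radius `‖q‖ / 8` about the origin (`measure_frontier_le_mul_measure_diff_ball`).
There `polar F` is at least a multiple of `‖q‖`, so momentum over perimeter is at least a multiple
of `‖q‖ ^ p` (`exists_mul_norm_rpow_le_functional_mul`). A bounded functional thus forces a lower
bound on the volume, and inside the unit ball this gives a lower bound on the inradius
(`exists_ball_subset_of_le_volume`).

Compactness: the sets are now unit balls of gauges `N k` centred at `x k`, squeezed between balls of
fixed radii. The gauges are equi-Lipschitz, so centres and gauges converge along a subsequence
(`exists_subseq_tendsto`).

Continuity: radial projection charts and the area formula turn boundary integrals into integrals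
over bounded subsets of hyperplanes that do not depend on the gauge. The integrands involve the
gauge only through its value and gradient; gradients of pointwise convergent gauges converge at
common points of differentiability (`tendsto_fderiv`), which by Rademacher are almost all points.
Dominated convergence then gives `tendsto_functional`, and the limit body is a minimizer. -/

open Module
open scoped NNReal ENNReal Topology Pointwise

set_option linter.unusedSectionVars false

/-! ### Area formula for injective differentiable maps into a space of larger dimension. -/

section AreaFormula

variable {U V : Type*} [NormedAddCommGroup U] [InnerProductSpace ℝ U] [FiniteDimensional ℝ U]
  [MeasurableSpace U] [BorelSpace U]
  [NormedAddCommGroup V] [InnerProductSpace ℝ V] [FiniteDimensional ℝ V]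
  [MeasurableSpace V] [BorelSpace V]

theorem LipschitzOnWith.euclideanHausdorffMeasure_image_le {X Y : Type*} [EMetricSpace X]
    [MeasurableSpace X] [BorelSpace X] [EMetricSpace Y] [MeasurableSpace Y] [BorelSpace Y]
    {K : ℝ≥0} {f : X → Y} {s : Set X} (h : LipschitzOnWith K f s) (d : ℕ) :
    μHE[d] (f '' s) ≤ (K : ℝ≥0∞) ^ d * μHE[d] s := by
  simp only [Measure.euclideanHausdorffMeasure_def, Measure.smul_apply,
    Measure.nnreal_smul_coe_apply]
  rw [mul_left_comm]
  gcongr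
  simpa using h.hausdorffMeasure_image_le (d := (d : ℝ)) (by positivity)

theorem continuous_normDet : Continuous fun A : U →L[ℝ] V => (A : U →ₗ[ℝ] V).normDet := by
  have h : (fun A : U →L[ℝ] V => (A : U →ₗ[ℝ] V).normDet) =
      fun A : U →L[ℝ] V => √((A.adjoint ∘L A).det) := by
    funext A
    rw [← A.normDet_sq]
    simp [Real.sqrt_sq (LinearMap.normDet_nonneg _)]
  rw [h]
  refine Real.continuous_sqrt.comp (ContinuousLinearMap.continuous_det.comp ?_)
  exact (ContinuousLinearMap.adjoint.continuous).clm_comp continuous_id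

/-- On `A '' s` the map `f ∘ A⁻¹` is Lipschitz with constant `1 + K * δ`: the error `δ * ‖x - y‖` is
at most `K * δ * ‖A x - A y‖`. -/
theorem ApproximatesLinearOn.euclideanHausdorffMeasure_image_le {f : U → V} {A : U →L[ℝ] V}
    {s : Set U} {K δ : ℝ≥0} (hA : AntilipschitzWith K A) (hf : ApproximatesLinearOn f A s δ)
    (d : ℕ) : μHE[d] (f '' s) ≤ ((1 + K * δ : ℝ≥0) : ℝ≥0∞) ^ d * μHE[d] (A '' s) := by
  obtain ⟨g, hg⟩ := hA.injective.hasLeftInverse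
  have h : LipschitzOnWith (1 + K * δ) (f ∘ g) (A '' s) := by
    refine LipschitzOnWith.of_dist_le_mul ?_
    rintro _ ⟨x, hx, rfl⟩ _ ⟨y, hy, rfl⟩
    simp only [Function.comp, hg x, hg y]
    have h1 := hf x hx y hy
    have h2 : ‖x - y‖ ≤ K * ‖A x - A y‖ := by
      simpa [dist_eq_norm] using hA.le_mul_dist x y
    have h3 : ‖f x - f y‖ ≤ ‖A x - A y‖ + ‖f x - f y - A (x - y)‖ := by
      have := norm_add_le (A x - A y) (f x - f y - A (x - y))
      simpa [map_sub] using this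
    rw [dist_eq_norm, dist_eq_norm]
    push_cast
    have : (δ : ℝ) * ‖x - y‖ ≤ δ * (K * ‖A x - A y‖) := by gcongr
    nlinarith
  have := h.euclideanHausdorffMeasure_image_le d
  rw [image_image] at this
  simpa [hg _] using this

/-- The reverse comparison: `A ∘ f⁻¹` is Lipschitz on `f '' s` with constant `(1 - K * δ)⁻¹`, which
also makes `f` injective there. -/
theorem ApproximatesLinearOn.le_euclideanHausdorffMeasure_image {f : U → V} {A : U →L[ℝ] V}
    {s : Set U} {K δ : ℝ≥0} (hA : AntilipschitzWith K A) (hf : ApproximatesLinearOn f A s δ)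
    (hδ : K * δ < 1) (d : ℕ) :
    μHE[d] (A '' s) ≤ (((1 - K * δ)⁻¹ : ℝ≥0) : ℝ≥0∞) ^ d * μHE[d] (f '' s) := by
  have key : ∀ x ∈ s, ∀ y ∈ s, ‖A x - A y‖ ≤ ((1 - K * δ)⁻¹ : ℝ≥0) * ‖f x - f y‖ := by
    intro x hx y hy
    have h1 := hf x hx y hy
    have h2 : ‖x - y‖ ≤ K * ‖A x - A y‖ := by
      simpa [dist_eq_norm] using hA.le_mul_dist x y
    have h3 : ‖A x - A y‖ ≤ ‖f x - f y‖ + ‖f x - f y - A (x - y)‖ := by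
      have := norm_sub_le (f x - f y) (f x - f y - A (x - y))
      simpa [map_sub] using this
    have h4 : (δ : ℝ) * ‖x - y‖ ≤ δ * (K * ‖A x - A y‖) := by gcongr
    have h5 : (K * δ : ℝ) < 1 := by exact_mod_cast hδ
    rw [NNReal.coe_inv, NNReal.coe_sub hδ.le, inv_mul_eq_div, le_div_iff₀ (by push_cast; linarith)]
    push_cast
    nlinarith
  have hinj : InjOn f s := by
    intro x hx y hy hxy
    have := key x hx y hy
    rw [hxy, sub_self, norm_zero, mul_zero] at this
    exact hA.injective (sub_eq_zero.1 (norm_le_zero_iff.1 this))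
  rcases isEmpty_or_nonempty U with hU | hU
  · simp [Set.eq_empty_of_isEmpty s]
  have h : LipschitzOnWith (1 - K * δ)⁻¹ (A ∘ Function.invFunOn f s) (f '' s) := by
    refine LipschitzOnWith.of_dist_le_mul ?_
    rintro _ ⟨x, hx, rfl⟩ _ ⟨y, hy, rfl⟩
    simp only [Function.comp, hinj.leftInvOn_invFunOn hx, hinj.leftInvOn_invFunOn hy]
    simpa [dist_eq_norm] using key x hx y hy
  have := h.euclideanHausdorffMeasure_image_le d
  rw [image_image] at this
  convert this using 2
  exact image_congr fun x hx => by simp [hinj.leftInvOn_invFunOn hx]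

/-- Local form of the area formula with multiplicative error `c`. All small `δ` work, since both
Lipschitz constants tend to 1 and `normDet` is continuous and positive at the injective map `A`. -/
theorem exists_area_formula_radius {A : U →L[ℝ] V} (hA : Function.Injective A) {c : ℝ≥0}
    (hc : 1 < c) : ∃ δ : ℝ≥0, 0 < δ ∧
      (∀ (f : U → V) (s : Set U), ApproximatesLinearOn f A s δ →
        μHE[finrank ℝ U] (f '' s) ≤
            c * (ENNReal.ofReal (A : U →ₗ[ℝ] V).normDet * volume s) ∧
        ENNReal.ofReal (A : U →ₗ[ℝ] V).normDet * volume s ≤ c * μHE[finrank ℝ U] (f '' s)) ∧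
      ∀ B : U →L[ℝ] V, B ∈ Metric.ball A δ →
        ENNReal.ofReal (B : U →ₗ[ℝ] V).normDet ≤
            c * ENNReal.ofReal (A : U →ₗ[ℝ] V).normDet ∧
        ENNReal.ofReal (A : U →ₗ[ℝ] V).normDet ≤
            c * ENNReal.ofReal (B : U →ₗ[ℝ] V).normDet := by
  obtain ⟨K, hK0, hK⟩ := A.exists_antilipschitzWith (LinearMap.ker_eq_bot.2 hA)
  have hJ : 0 < (A : U →ₗ[ℝ] V).normDet := by
    refine lt_of_le_of_ne (LinearMap.normDet_nonneg _) (Ne.symm ?_)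
    exact ((LinearMap.normDet_ne_zero_tfae (A : U →ₗ[ℝ] V)).out 0 4).2 hA
  have e1 : ∀ᶠ δ : ℝ≥0 in 𝓝[>] 0, (1 + K * δ) ^ finrank ℝ U < c := by
    refine nhdsWithin_le_nhds ?_
    have : Filter.Tendsto (fun δ : ℝ≥0 => (1 + K * δ) ^ finrank ℝ U) (𝓝 0)
        (𝓝 ((1 + K * 0) ^ finrank ℝ U)) := Continuous.tendsto (by fun_prop) _
    exact this.eventually (gt_mem_nhds (by simpa using hc))
  have e2 : ∀ᶠ δ : ℝ≥0 in 𝓝[>] 0, (1 - K * δ)⁻¹ ^ finrank ℝ U < c := by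
    refine nhdsWithin_le_nhds ?_
    have : Filter.Tendsto (fun δ : ℝ≥0 => (1 - K * δ)⁻¹ ^ finrank ℝ U) (𝓝 0)
        (𝓝 ((1 - K * 0)⁻¹ ^ finrank ℝ U)) := by
      refine Filter.Tendsto.pow (Filter.Tendsto.inv₀ ?_ (by simp)) _
      exact Continuous.tendsto (by fun_prop) _
    exact this.eventually (gt_mem_nhds (by simpa using hc))
  have e3 : ∀ᶠ δ : ℝ≥0 in 𝓝[>] 0, K * δ < 1 := by
    refine nhdsWithin_le_nhds ?_
    have : Filter.Tendsto (fun δ : ℝ≥0 => K * δ) (𝓝 0) (𝓝 (K * 0)) :=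
      Continuous.tendsto (by fun_prop) _
    exact this.eventually (gt_mem_nhds (by simp))
  obtain ⟨η, hη, hη'⟩ : ∃ η : ℝ, 0 < η ∧ ∀ B : U →L[ℝ] V, B ∈ Metric.ball A η →
      (B : U →ₗ[ℝ] V).normDet < c * (A : U →ₗ[ℝ] V).normDet ∧
      (A : U →ₗ[ℝ] V).normDet < c * (B : U →ₗ[ℝ] V).normDet := by
    have hc' : (1 : ℝ) < c := by exact_mod_cast hc
    have h1 : ∀ᶠ B : U →L[ℝ] V in 𝓝 A,
        (B : U →ₗ[ℝ] V).normDet < c * (A : U →ₗ[ℝ] V).normDet :=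
      continuous_normDet.tendsto A |>.eventually (gt_mem_nhds (by nlinarith))
    have h2 : ∀ᶠ B : U →L[ℝ] V in 𝓝 A,
        (A : U →ₗ[ℝ] V).normDet < c * (B : U →ₗ[ℝ] V).normDet :=
      (continuous_normDet.const_mul (c : ℝ)).tendsto A |>.eventually (lt_mem_nhds (by nlinarith))
    obtain ⟨η, hη, h⟩ := Metric.eventually_nhds_iff_ball.1 (h1.and h2)
    exact ⟨η, hη, h⟩
  have e4 : ∀ᶠ δ : ℝ≥0 in 𝓝[>] 0, (δ : ℝ) < η := by
    refine nhdsWithin_le_nhds ?_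
    exact (NNReal.continuous_coe.tendsto 0).eventually (gt_mem_nhds (by simpa using hη))
  obtain ⟨δ, h1, h2, h3, h4, hδ⟩ :=
    (e1.and (e2.and (e3.and (e4.and self_mem_nhdsWithin)))).exists
  refine ⟨δ, hδ, fun f s hf => ⟨?_, ?_⟩, fun B hB => ?_⟩
  · refine (hf.euclideanHausdorffMeasure_image_le hK _).trans ?_
    rw [← LinearMap.euclideanHausdorffMeasure_image_eq_normDet_mul_volume]
    refine mul_le_mul' ?_ le_rfl
    exact_mod_cast h1.le
  · rw [← LinearMap.euclideanHausdorffMeasure_image_eq_normDet_mul_volume]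
    refine (hf.le_euclideanHausdorffMeasure_image hK h3 _).trans ?_
    refine mul_le_mul' ?_ le_rfl
    exact_mod_cast h2.le
  · obtain ⟨h5, h6⟩ := hη' B (Metric.ball_subset_ball h4.le hB)
    have hcc : (c : ℝ≥0∞) = ENNReal.ofReal c := by simp
    rw [hcc, ← ENNReal.ofReal_mul (by positivity), ← ENNReal.ofReal_mul (by positivity)]
    exact ⟨ENNReal.ofReal_le_ofReal h5.le, ENNReal.ofReal_le_ofReal h6.le⟩


/-- The derivatives form a separable set, so countably many reference maps `A i` suffice. The error
is `c ^ 2`: one factor for comparing `f` with `A i`, one for comparing `normDet` of `f' x` with that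
of `A i`. -/
theorem exists_countable_cover_area_formula {f : U → V} {f' : U → U →L[ℝ] V} {s : Set U}
    (hf : ∀ x ∈ s, HasFDerivWithinAt f (f' x) s x)
    (hf'inj : ∀ x ∈ s, Function.Injective (f' x)) (hf'm : Measurable f') {c : ℝ≥0} (hc : 1 < c) :
    ∃ u : ℕ → Set U, (∀ n, MeasurableSet (u n)) ∧ s ⊆ ⋃ n, u n ∧
      ∀ n, ∀ t ⊆ s ∩ u n, MeasurableSet t →
        μHE[finrank ℝ U] (f '' t) ≤
          c ^ 2 * ∫⁻ x in t, ENNReal.ofReal (f' x : U →ₗ[ℝ] V).normDet ∧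
        ∫⁻ x in t, ENNReal.ofReal (f' x : U →ₗ[ℝ] V).normDet ≤
          c ^ 2 * μHE[finrank ℝ U] (f '' t) := by
  classical
  -- The set of reference maps must be nonempty to be enumerated by `ℕ`.
  rcases s.eq_empty_or_nonempty with rfl | ⟨z, hz⟩
  · refine ⟨fun _ => ∅, by simp, by simp, ?_⟩
    rintro n t ht -
    obtain rfl : t = ∅ := by simpa using ht
    simp
  -- Non-injective maps receive the dummy radius 1, so that `δ` is defined on all linear maps.
  have hrad : ∀ A : U →L[ℝ] V, ∃ δ : ℝ≥0, 0 < δ ∧ (Function.Injective A →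
      (∀ (f : U → V) (s : Set U), ApproximatesLinearOn f A s δ →
        μHE[finrank ℝ U] (f '' s) ≤
            c * (ENNReal.ofReal (A : U →ₗ[ℝ] V).normDet * volume s) ∧
        ENNReal.ofReal (A : U →ₗ[ℝ] V).normDet * volume s ≤ c * μHE[finrank ℝ U] (f '' s)) ∧
      ∀ B : U →L[ℝ] V, B ∈ Metric.ball A δ →
        ENNReal.ofReal (B : U →ₗ[ℝ] V).normDet ≤
            c * ENNReal.ofReal (A : U →ₗ[ℝ] V).normDet ∧
        ENNReal.ofReal (A : U →ₗ[ℝ] V).normDet ≤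
            c * ENNReal.ofReal (B : U →ₗ[ℝ] V).normDet) := by
    intro A
    by_cases hA : Function.Injective A
    · obtain ⟨δ, h0, h⟩ := exists_area_formula_radius hA hc
      exact ⟨δ, h0, fun _ => h⟩
    · exact ⟨1, one_pos, fun h => absurd h hA⟩
  choose δ hδ0 hδ using hrad
  obtain ⟨T, hTs, hTc, hT⟩ := TopologicalSpace.countable_cover_nhdsWithin
    (f := fun A : U →L[ℝ] V => Metric.ball A (δ A / 2)) (s := f' '' s)
    (fun A _ => mem_nhdsWithin_of_mem_nhds (Metric.ball_mem_nhds _ (by have := hδ0 A; positivity)))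
  have hTne : T.Nonempty := by
    obtain ⟨A, hA, -⟩ := mem_iUnion₂.1 (hT (mem_image_of_mem f' hz))
    exact ⟨A, hA⟩
  obtain ⟨A, hA⟩ := hTc.exists_eq_range hTne
  have hAs : ∀ i, ∃ y ∈ s, f' y = A i := fun i => hTs (hA ▸ mem_range_self i)
  have hAinj : ∀ i, Function.Injective (A i) := by
    intro i
    obtain ⟨y, hy, h⟩ := hAs i
    exact h ▸ hf'inj y hy
  let S : ℕ → Set U := fun i => s ∩ f' ⁻¹' Metric.ball (A i) (δ (A i) / 2)
  have hpart : ∀ i, ∃ (t : ℕ → Set U) (B : ℕ → U →L[ℝ] V), (∀ n, IsClosed (t n)) ∧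
      S i ⊆ ⋃ n, t n ∧ (∀ n, ApproximatesLinearOn f (B n) (S i ∩ t n) (δ (A i) / 2)) ∧
      ((S i).Nonempty → ∀ n, ∃ y ∈ S i, B n = f' y) := fun i =>
    exists_closed_cover_approximatesLinearOn_of_hasFDerivWithinAt f (S i) f'
      (fun x hx => (hf x hx.1).mono inter_subset_left) (fun _ => δ (A i) / 2)
      (fun _ => by have := hδ0 (A i); positivity)
  choose t B htc htS htB hB using hpart
  refine ⟨fun k => f' ⁻¹' Metric.ball (A k.unpair.1) (δ (A k.unpair.1) / 2) ∩
    t k.unpair.1 k.unpair.2, fun k => ?_, fun x hx => ?_, fun k r hr hrm => ?_⟩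
  · exact (hf'm Metric.isOpen_ball.measurableSet).inter (htc _ _).measurableSet
  · obtain ⟨A', hA', hx'⟩ := mem_iUnion₂.1 (hT (mem_image_of_mem f' hx))
    obtain ⟨i, rfl⟩ := hA ▸ hA'
    have hxS : x ∈ S i := ⟨hx, hx'⟩
    obtain ⟨j, hj⟩ := mem_iUnion.1 (htS i hxS)
    exact mem_iUnion.2 ⟨Nat.pair i j, by simpa using ⟨hx', hj⟩⟩
  · set i := k.unpair.1
    set j := k.unpair.2
    have hrS : r ⊆ S i ∩ t i j := fun x hx => ⟨⟨(hr hx).1, (hr hx).2.1⟩, (hr hx).2.2⟩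
    have hball : ∀ x ∈ r, f' x ∈ Metric.ball (A i) (δ (A i)) := fun x hx =>
      Metric.ball_subset_ball (half_le_self (δ (A i)).2) (hr hx).2.1
    -- Two errors of `δ / 2` add up: `f` against its own reference `B i j`, and `B i j`, a
    -- derivative at a point of `S i`, against `A i`.
    have happ : ApproximatesLinearOn f (A i) r (δ (A i)) := by
      intro x hx y hy
      obtain ⟨w, hw, hBw⟩ := hB i ⟨x, (hrS hx).1⟩ j
      have h1 := htB i j x (hrS hx) y (hrS hy)
      have h2 : ‖B i j - A i‖ ≤ δ (A i) / 2 := by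
        rw [hBw]
        have := hw.2
        rw [mem_preimage, Metric.mem_ball, dist_eq_norm] at this
        exact this.le
      have h3 : ‖(B i j - A i) (x - y)‖ ≤ δ (A i) / 2 * ‖x - y‖ :=
        (ContinuousLinearMap.le_opNorm _ _).trans (by gcongr)
      have h4 : f x - f y - A i (x - y) =
          (f x - f y - B i j (x - y)) + (B i j - A i) (x - y) := by
        simp
      rw [h4]
      refine (norm_add_le _ _).trans ?_
      push_cast at h1
      linarith
    obtain ⟨h1, h2⟩ := (hδ (A i) (hAinj i)).1 f r happ
    have h3 := (hδ (A i) (hAinj i)).2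
    have hconst : ENNReal.ofReal (A i : U →ₗ[ℝ] V).normDet * volume r =
        ∫⁻ x in r, ENNReal.ofReal (A i : U →ₗ[ℝ] V).normDet := by simp
    have hcm : Measurable fun x => ENNReal.ofReal (f' x : U →ₗ[ℝ] V).normDet :=
      (continuous_normDet.measurable.comp hf'm).ennreal_ofReal
    constructor
    · refine h1.trans ?_
      rw [sq, mul_assoc, hconst, ← lintegral_const_mul _ hcm]
      gcongr 1
      exact setLIntegral_mono' hrm fun x hx => (h3 _ (hball x hx)).2
    · calc ∫⁻ x in r, ENNReal.ofReal (f' x : U →ₗ[ℝ] V).normDet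
          ≤ ∫⁻ x in r, c * ENNReal.ofReal (A i : U →ₗ[ℝ] V).normDet :=
            setLIntegral_mono' hrm fun x hx => (h3 _ (hball x hx)).1
        _ = c * (ENNReal.ofReal (A i : U →ₗ[ℝ] V).normDet * volume r) := by
            rw [lintegral_const_mul _ measurable_const, hconst]
        _ ≤ _ := by
            rw [sq, mul_assoc]
            gcongr

/-- The cover is made disjoint, the two-sided estimates are summed using injectivity of `f`, and `c`
tends to 1. -/
theorem lintegral_normDet_eq_euclideanHausdorffMeasure_image {f : U → V} {f' : U → U →L[ℝ] V}
    {s : Set U} (hs : MeasurableSet s) (hf : ∀ x ∈ s, HasFDerivWithinAt f (f' x) s x)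
    (hinj : InjOn f s) (hf'inj : ∀ x ∈ s, Function.Injective (f' x)) (hf'm : Measurable f') :
    ∫⁻ x in s, ENNReal.ofReal (f' x : U →ₗ[ℝ] V).normDet = μHE[finrank ℝ U] (f '' s) := by
  have hcont : ContinuousOn f s := fun x hx => (hf x hx).continuousWithinAt
  have key : ∀ c : ℝ≥0, 1 < c →
      μHE[finrank ℝ U] (f '' s) ≤
          c ^ 2 * ∫⁻ x in s, ENNReal.ofReal (f' x : U →ₗ[ℝ] V).normDet ∧
      ∫⁻ x in s, ENNReal.ofReal (f' x : U →ₗ[ℝ] V).normDet ≤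
          c ^ 2 * μHE[finrank ℝ U] (f '' s) := by
    intro c hc
    obtain ⟨u, hum, hsu, hu⟩ := exists_countable_cover_area_formula hf hf'inj hf'm hc
    have hdm : ∀ n, MeasurableSet (s ∩ disjointed u n) := fun n =>
      hs.inter (MeasurableSet.disjointed hum n)
    have hd : Pairwise (Function.onFun Disjoint fun n => s ∩ disjointed u n) := fun m n hmn =>
      (disjoint_disjointed u hmn).mono inter_subset_right inter_subset_right
    have hsU : s = ⋃ n, s ∩ disjointed u n := by
      rw [← inter_iUnion, iUnion_disjointed]
      exact (inter_eq_left.2 hsu).symm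
    have hu' := fun n => hu n (s ∩ disjointed u n)
      (inter_subset_inter_right _ (disjointed_subset u n)) (hdm n)
    have hsum1 : ∫⁻ x in s, ENNReal.ofReal (f' x : U →ₗ[ℝ] V).normDet =
        ∑' n, ∫⁻ x in s ∩ disjointed u n, ENNReal.ofReal (f' x : U →ₗ[ℝ] V).normDet := by
      conv_lhs => rw [hsU]
      exact lintegral_iUnion hdm hd _
    have hsum2 : μHE[finrank ℝ U] (f '' s) =
        ∑' n, μHE[finrank ℝ U] (f '' (s ∩ disjointed u n)) := by
      conv_lhs => rw [hsU, image_iUnion]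
      refine measure_iUnion (fun m n hmn => ?_) fun n => ?_
      · rw [Function.onFun, disjoint_left]
        rintro _ ⟨x, hx, rfl⟩ ⟨y, hy, hxy⟩
        rw [hinj hy.1 hx.1 hxy] at hy
        exact disjoint_left.1 (hd hmn) hx hy
      · exact (hdm n).image_of_continuousOn_injOn (hcont.mono inter_subset_left)
          (hinj.mono inter_subset_left)
    rw [hsum1, hsum2, ← ENNReal.tsum_mul_left, ← ENNReal.tsum_mul_left]
    exact ⟨ENNReal.tsum_le_tsum fun n => (hu' n).1, ENNReal.tsum_le_tsum fun n => (hu' n).2⟩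
  have hlim : ∀ a b : ℝ≥0∞, (∀ c : ℝ≥0, 1 < c → a ≤ c ^ 2 * b) → a ≤ b := by
    intro a b h
    have h1 : Filter.Tendsto (fun c : ℝ≥0 => ((c ^ 2 : ℝ≥0) : ℝ≥0∞) * b) (𝓝[>] 1)
        (𝓝 (((1 ^ 2 : ℝ≥0) : ℝ≥0∞) * b)) := by
      refine ENNReal.Tendsto.mul_const ?_ (Or.inl (by simp))
      refine (ENNReal.continuous_coe.comp (continuous_pow 2)).continuousWithinAt.tendsto
    simp only [one_pow, ENNReal.coe_one, one_mul] at h1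
    refine ge_of_tendsto h1 ?_
    filter_upwards [self_mem_nhdsWithin] with c hc
    simpa using h c hc
  exact le_antisymm (hlim _ _ fun c hc => (key c hc).2) (hlim _ _ fun c hc => (key c hc).1)

theorem map_withDensity_normDet {f : U → V} {f' : U → U →L[ℝ] V} {s : Set U}
    (hs : MeasurableSet s) (hf : ∀ x ∈ s, HasFDerivWithinAt f (f' x) s x)
    (hinj : InjOn f s) (hf'inj : ∀ x ∈ s, Function.Injective (f' x)) (hf'm : Measurable f')
    (hfm : Measurable f) :
    Measure.map f ((volume.restrict s).withDensity
      fun x => ENNReal.ofReal (f' x : U →ₗ[ℝ] V).normDet) =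
      μHE[finrank ℝ U].restrict (f '' s) := by
  ext t ht
  rw [Measure.map_apply hfm ht, withDensity_apply _ (hfm ht), Measure.restrict_apply ht,
    Measure.restrict_restrict (hfm ht), inter_comm,
    lintegral_normDet_eq_euclideanHausdorffMeasure_image (hs.inter (hfm ht))
      (fun x hx => (hf x hx.1).mono inter_subset_left) (hinj.mono inter_subset_left)
      (fun x hx => hf'inj x hx.1) hf'm, image_inter_preimage, inter_comm]

theorem integral_image_eq_integral_normDet_mul {f : U → V} {f' : U → U →L[ℝ] V} {s : Set U}
    (hs : MeasurableSet s) (hf : ∀ x ∈ s, HasFDerivWithinAt f (f' x) s x)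
    (hinj : InjOn f s) (hf'inj : ∀ x ∈ s, Function.Injective (f' x)) (hf'm : Measurable f')
    (hfm : Measurable f) {g : V → ℝ}
    (hg : AEStronglyMeasurable g (μHE[finrank ℝ U].restrict (f '' s))) :
    ∫ x in f '' s, g x ∂μHE[finrank ℝ U] =
      ∫ x in s, (f' x : U →ₗ[ℝ] V).normDet * g (f x) := by
  have hcm : Measurable fun x => (f' x : U →ₗ[ℝ] V).normDet :=
    continuous_normDet.measurable.comp hf'm
  rw [← map_withDensity_normDet hs hf hinj hf'inj hf'm hfm] at hg ⊢
  rw [integral_map hfm.aemeasurable hg,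
    integral_withDensity_eq_integral_toReal_smul hcm.ennreal_ofReal (by simp)]
  simp [ENNReal.toReal_ofReal (LinearMap.normDet_nonneg _)]

end AreaFormula

/-! ### Gauges, the convex bodies they define, and their normals. -/

/-- A nonsymmetric norm `N` whose unit ball contains the ball of radius `r` and is contained in
the ball of radius `R`. -/
structure IsGauge {W : Type*} [NormedAddCommGroup W] [NormedSpace ℝ W] (r R : ℝ) (N : W → ℝ) :
    Prop where
  r_pos : 0 < r
  R_pos : 0 < R
  add_le : ∀ x y, N (x + y) ≤ N x + N y
  smul : ∀ t : ℝ, 0 ≤ t → ∀ x, N (t • x) = t * N x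
  lower : ∀ x, ‖x‖ ≤ R * N x
  upper : ∀ x, r * N x ≤ ‖x‖

/-- The open unit ball of `N`, centered at `a`. -/
def gaugeBody {W : Type*} [NormedAddCommGroup W] (N : W → ℝ) (a : W) : Set W :=
  {x | N (x - a) < 1}

namespace IsGauge

variable {W : Type*} [NormedAddCommGroup W] [InnerProductSpace ℝ W] [FiniteDimensional ℝ W]
  {r R : ℝ} {N : W → ℝ} {a x : W} {L : W →L[ℝ] ℝ}

theorem zero (h : IsGauge r R N) : N 0 = 0 := by
  simpa using h.smul 0 le_rfl 0

theorem nonneg (h : IsGauge r R N) (x : W) : 0 ≤ N x := by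
  have := h.lower x
  have := norm_nonneg x
  by_contra! h0
  nlinarith [h.R_pos]

theorem pos (h : IsGauge r R N) (hx : x ≠ 0) : 0 < N x := by
  have := h.lower x
  have := norm_pos_iff.2 hx
  by_contra! h0
  nlinarith [h.R_pos]

theorem lipschitzWith (h : IsGauge r R N) : LipschitzWith (r⁻¹).toNNReal N := by
  refine LipschitzWith.of_le_add_mul _ fun x y => ?_
  rw [Real.coe_toNNReal _ (inv_nonneg.2 h.r_pos.le), dist_eq_norm, inv_mul_eq_div]
  have h1 := h.add_le y (x - y)
  rw [add_sub_cancel] at h1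
  have h2 : N (x - y) ≤ ‖x - y‖ / r := by
    rw [le_div_iff₀ h.r_pos, mul_comm]
    exact h.upper _
  linarith

theorem continuous (h : IsGauge r R N) : Continuous N := h.lipschitzWith.continuous

theorem isOpen_gaugeBody (h : IsGauge r R N) : IsOpen (gaugeBody N a) :=
  isOpen_lt (h.continuous.comp (continuous_id.sub continuous_const)) continuous_const

theorem mem_gaugeBody (h : IsGauge r R N) : a ∈ gaugeBody N a := by
  simp [gaugeBody, h.zero]

theorem convex_gaugeBody (h : IsGauge r R N) : Convex ℝ (gaugeBody N a) := by
  intro x hx y hy s t hs ht hst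
  simp only [gaugeBody, mem_ofPred_eq] at *
  have : s • x + t • y - a = s • (x - a) + t • (y - a) := by
    rw [smul_sub, smul_sub, sub_add_sub_comm, ← add_smul, hst, one_smul]
  rw [this]
  refine (h.add_le _ _).trans_lt ?_
  rw [h.smul s hs, h.smul t ht]
  rcases hs.eq_or_lt with rfl | hs
  · obtain rfl : t = 1 := by linarith
    simpa using hy
  · nlinarith [mul_lt_mul_of_pos_left hx hs, mul_le_mul_of_nonneg_left hy.le ht]

theorem gaugeBody_subset_ball (h : IsGauge r R N) : gaugeBody N a ⊆ Metric.ball a R := by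
  intro x hx
  rw [Metric.mem_ball, dist_eq_norm]
  have h1 : N (x - a) < 1 := hx
  have := h.lower (x - a)
  nlinarith [h.R_pos]

theorem mem_admissible {n : ℕ} {N : AnisotropicMomentum.E n → ℝ} {a : AnisotropicMomentum.E n}
    (h : IsGauge r R N) : gaugeBody N a ∈ AnisotropicMomentum.admissible n :=
  ⟨⟨a, h.mem_gaugeBody⟩, Metric.isBounded_ball.subset h.gaugeBody_subset_ball,
    h.isOpen_gaugeBody, h.convex_gaugeBody⟩

/-- Points of the level set are limits of their radial contractions towards `a`, which lie in the
body. -/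
theorem frontier_gaugeBody (h : IsGauge r R N) :
    frontier (gaugeBody N a) = {x | N (x - a) = 1} := by
  have hc : Continuous fun x => N (x - a) := h.continuous.comp (continuous_id.sub continuous_const)
  refine Subset.antisymm (frontier_lt_subset_eq hc continuous_const) fun x hx => ?_
  have hx1 : N (x - a) = 1 := hx
  rw [h.isOpen_gaugeBody.frontier_eq]
  refine ⟨?_, fun h' => (ne_of_lt h') hx1⟩
  have h1 : Filter.Tendsto (fun t : ℝ => a + t • (x - a)) (𝓝[<] 1) (𝓝 (a + (1 : ℝ) • (x - a))) :=
    (Continuous.tendsto (by fun_prop) _).mono_left nhdsWithin_le_nhds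
  rw [one_smul, add_sub_cancel] at h1
  refine mem_closure_of_tendsto h1 ?_
  have h2 : ∀ᶠ t : ℝ in 𝓝[<] 1, 0 < t := nhdsWithin_le_nhds (lt_mem_nhds one_pos)
  filter_upwards [h2, self_mem_nhdsWithin] with t ht0 ht1
  simp only [gaugeBody, mem_ofPred_eq, add_sub_cancel_left, h.smul t ht0.le, hx1, mul_one]
  exact ht1

/-- A bounded open convex set is the unit ball of its Minkowski functional. -/
theorem exists_of_convex {Ω : Set W} (ho : IsOpen Ω) (hc : Convex ℝ Ω) (hr : 0 < r) (hR : 0 < R)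
    (h1 : Metric.ball a r ⊆ Ω) (h2 : Ω ⊆ Metric.closedBall a R) :
    ∃ N : W → ℝ, IsGauge r R N ∧ gaugeBody N a = Ω := by
  set s : Set W := (fun y => a + y) ⁻¹' Ω with hs
  have hso : IsOpen s := ho.preimage (by fun_prop)
  have hsc : Convex ℝ s := hc.translate_preimage_right a
  have hs1 : Metric.ball 0 r ⊆ s := fun y hy => h1 (by simpa using hy)
  have hs2 : s ⊆ Metric.closedBall 0 R := fun y hy => by simpa using h2 hy
  have hs0 : (0 : W) ∈ s := hs1 (Metric.mem_ball_self hr)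
  have habs : Absorbent ℝ s := absorbent_nhds_zero (hso.mem_nhds hs0)
  refine ⟨gauge s, ⟨hr, hR, gauge_add_le hsc habs, fun t ht x => ?_, fun x => ?_, fun x => ?_⟩, ?_⟩
  · simpa using gauge_smul_of_nonneg ht x
  · have := le_gauge_of_subset_closedBall habs hR.le hs2 (x := x)
    rw [div_le_iff₀ hR] at this
    linarith
  · exact mul_gauge_le_norm hs1
  · ext x
    have := Set.ext_iff.1 (setOfPred_gauge_lt_one_eq_self_of_isOpen hsc hs0 hso) (x - a)
    simpa [gaugeBody, hs] using this

theorem fderiv_le (h : IsGauge r R N) (hL : HasFDerivAt N L x) (y : W) : L y ≤ N y := by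
  have h1 : HasDerivAt (fun t : ℝ => N (x + t • y)) (L y) 0 := by
    have h2 : HasDerivAt (fun t : ℝ => x + t • y) y 0 := by
      simpa using ((hasDerivAt_id (0 : ℝ)).smul_const y).const_add x
    have h3 : HasFDerivAt N L (x + (0 : ℝ) • y) := by simpa using hL
    exact h3.comp_hasDerivAt 0 h2
  have h4 := h1.tendsto_slope_zero_right
  refine le_of_tendsto h4 ?_
  filter_upwards [self_mem_nhdsWithin] with t ht
  have ht : 0 < t := ht
  have h5 := h.add_le x (t • y)
  rw [h.smul t ht.le] at h5
  simp only [zero_add, zero_smul, add_zero, smul_eq_mul]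
  rw [inv_mul_le_iff₀ ht]
  linarith

theorem fderiv_self (h : IsGauge r R N) (hL : HasFDerivAt N L x) : L x = N x := by
  have h2 : HasDerivAt (fun t : ℝ => t • x) x 1 := by
    simpa using (hasDerivAt_id (1 : ℝ)).smul_const x
  have h3 : HasFDerivAt N L ((1 : ℝ) • x) := by simpa using hL
  have h1 := h3.comp_hasDerivAt 1 h2
  have h4 : HasDerivAt (fun t : ℝ => t * N x) (N x) 1 := by
    simpa using (hasDerivAt_id (1 : ℝ)).mul_const (N x)
  refine h1.unique (h4.congr_of_eventuallyEq ?_)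
  filter_upwards [lt_mem_nhds one_pos] with t ht
  exact h.smul t ht.le x

theorem fderiv_le_sub (h : IsGauge r R N) (hL : HasFDerivAt N L x) (y : W) :
    L y ≤ N (x + y) - N x := by
  have h1 := h.fderiv_le hL (x + y)
  rw [map_add, h.fderiv_self hL] at h1
  linarith

theorem hasFDerivAt_smul (h : IsGauge r R N) (hL : HasFDerivAt N L x) {t : ℝ} (ht : 0 < t) :
    HasFDerivAt N L (t • x) := by
  have h1 : HasFDerivAt (fun y : W => t⁻¹ • y) (t⁻¹ • ContinuousLinearMap.id ℝ W) (t • x) :=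
    (hasFDerivAt_id (t • x)).const_smul t⁻¹
  have h2 : HasFDerivAt N L (t⁻¹ • t • x) := by rwa [inv_smul_smul₀ ht.ne']
  have h3 := (h2.comp (t • x) h1).const_mul t
  have h4 : N = fun y => t * (N ∘ fun y : W => t⁻¹ • y) y := by
    funext y
    simp only [Function.comp]
    rw [← h.smul t ht.le, smul_inv_smul₀ ht.ne']
  have h5 : t • L ∘SL (t⁻¹ • ContinuousLinearMap.id ℝ W) = L := by
    ext y
    simp [ht.ne']
  rwa [← h4, h5] at h3

theorem norm_gradient_pos (h : IsGauge r R N) (hx : 0 < N x) (hN : DifferentiableAt ℝ N x) :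
    0 < ‖gradient N x‖ := by
  rw [norm_pos_iff]
  intro h0
  have h1 := h.fderiv_self hN.hasFDerivAt
  rw [← inner_gradient_left, h0, inner_zero_left] at h1
  exact hx.ne h1

/-- The supporting half-space inequality, tested on `a + t⁻¹ • y` as `t` decreases to `N y`, says
that `⟨y, ν⟩ ≤ c * N y` with equality at `x - a`. So `x - a` minimizes the difference and `ν` is `c`
times the gradient; `‖ν‖ = 1` fixes `c`. The converse is the subgradient inequality. -/
theorem isOuterUnitNormal_iff {n : ℕ} {N : AnisotropicMomentum.E n → ℝ}
    {a x ν : AnisotropicMomentum.E n} (h : IsGauge r R N) (hx : N (x - a) = 1)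
    (hN : DifferentiableAt ℝ N (x - a)) :
    AnisotropicMomentum.IsOuterUnitNormal (gaugeBody N a) x ν ↔
      ν = ‖gradient N (x - a)‖⁻¹ • gradient N (x - a) := by
  have hw := h.norm_gradient_pos (by rw [hx]; exact one_pos) hN
  constructor
  · rintro ⟨hν1, hν⟩
    set c := inner ℝ (x - a) ν with hc
    have hc0 : 0 ≤ c := by
      have := hν a h.mem_gaugeBody
      rw [← neg_sub, inner_neg_left] at this
      linarith
    have hle : ∀ y, inner ℝ y ν ≤ c * N y := by
      intro y
      have hstep : ∀ t : ℝ, N y < t → inner ℝ y ν ≤ c * t := by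
        intro t ht
        have ht0 : 0 < t := (h.nonneg y).trans_lt ht
        have hmem : a + t⁻¹ • y ∈ gaugeBody N a := by
          simp only [gaugeBody, mem_ofPred_eq, add_sub_cancel_left]
          rw [h.smul _ (inv_nonneg.2 ht0.le), inv_mul_lt_iff₀ ht0]
          linarith
        have h1 := hν _ hmem
        rw [show a + t⁻¹ • y - x = t⁻¹ • y - (x - a) by abel, inner_sub_left, inner_smul_left]
          at h1
        simp only [conj_trivial] at h1
        rw [sub_nonpos, inv_mul_le_iff₀ ht0] at h1
        rw [hc, mul_comm]
        exact h1
      have h2 : Filter.Tendsto (fun t => c * t) (𝓝[>] N y) (𝓝 (c * N y)) :=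
        (Continuous.tendsto (by fun_prop) _).mono_left nhdsWithin_le_nhds
      refine ge_of_tendsto h2 ?_
      filter_upwards [self_mem_nhdsWithin] with t ht using hstep t ht
    have hmin : IsLocalMin (fun y => c * N y - inner ℝ y ν) (x - a) := by
      refine Filter.Eventually.of_forall fun y => ?_
      simp only [hx, mul_one, ← hc, sub_self]
      linarith [hle y]
    have hd : HasFDerivAt (fun y => c * N y - inner ℝ y ν)
        (c • fderiv ℝ N (x - a) - innerSL ℝ ν) (x - a) := by
      refine (hN.hasFDerivAt.const_mul c).sub ?_
      simpa [real_inner_comm] using (innerSL ℝ ν).hasFDerivAt (x := x - a)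
    have h0 := hmin.hasFDerivAt_eq_zero hd
    have hνc : ν = c • gradient N (x - a) := by
      refine ext_inner_right ℝ fun y => ?_
      have := congrArg (fun T : AnisotropicMomentum.E n →L[ℝ] ℝ => T y) h0
      simp only [sub_apply, smul_apply, innerSL_apply_apply, zero_apply, smul_eq_mul] at this
      rw [inner_smul_left, inner_gradient_left]
      simp only [conj_trivial]
      linarith
    have hc1 : c * ‖gradient N (x - a)‖ = 1 := by
      rw [← hν1, hνc, norm_smul, Real.norm_of_nonneg hc0]
    rw [eq_inv_of_mul_eq_one_left hc1] at hνc
    exact hνc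
  · rintro rfl
    refine ⟨?_, fun y hy => ?_⟩
    · rw [norm_smul, norm_inv, norm_norm, inv_mul_cancel₀ hw.ne']
    · rw [inner_smul_right, real_inner_comm, inner_gradient_left]
      refine mul_nonpos_of_nonneg_of_nonpos (by positivity) ?_
      have h1 := h.fderiv_le_sub hN.hasFDerivAt (y - x)
      rw [show x - a + (y - x) = y - a by abel, hx] at h1
      have h2 : N (y - a) < 1 := hy
      linarith

theorem outerNormal_eq {n : ℕ} {N : AnisotropicMomentum.E n → ℝ}
    {a x : AnisotropicMomentum.E n} (h : IsGauge r R N) (hx : N (x - a) = 1)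
    (hN : DifferentiableAt ℝ N (x - a)) :
    AnisotropicMomentum.outerNormal (gaugeBody N a) x =
      ‖gradient N (x - a)‖⁻¹ • gradient N (x - a) := by
  have hex : ∃! ν, AnisotropicMomentum.IsOuterUnitNormal (gaugeBody N a) x ν :=
    ⟨_, (h.isOuterUnitNormal_iff hx hN).2 rfl, fun ν hν => (h.isOuterUnitNormal_iff hx hN).1 hν⟩
  rw [AnisotropicMomentum.outerNormal, dif_pos hex]
  exact (h.isOuterUnitNormal_iff hx hN).1 hex.choose_spec.1

theorem norm_outerNormal {n : ℕ} {N : AnisotropicMomentum.E n → ℝ}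
    {a x : AnisotropicMomentum.E n} (h : IsGauge r R N) (hx : N (x - a) = 1)
    (hN : DifferentiableAt ℝ N (x - a)) :
    ‖AnisotropicMomentum.outerNormal (gaugeBody N a) x‖ = 1 := by
  rw [h.outerNormal_eq hx hN]
  exact ((h.isOuterUnitNormal_iff hx hN).2 rfl).1

/-- By convexity `L' k y` is at most any forward difference quotient of `M k`. A quotient with fixed
step converges to that of `N`, which is close to `L y` for a small step; using `-y` as well bounds
`L' k y` from below. -/
theorem tendsto_fderiv {ι : Type*} {l : Filter ι} {M : ι → W → ℝ} {L' : ι → W →L[ℝ] ℝ}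
    (h : ∀ k, IsGauge r R (M k)) (hN : ∀ y, Filter.Tendsto (fun k => M k y) l (𝓝 (N y)))
    (hL' : ∀ k, HasFDerivAt (M k) (L' k) x) (hL : HasFDerivAt N L x) :
    Filter.Tendsto L' l (𝓝 L) := by
  have hup : ∀ y, ∀ ε > 0, ∀ᶠ k in l, L' k y < L y + ε := by
    intro y ε hε
    have h1 : HasDerivAt (fun t : ℝ => N (x + t • y)) (L y) 0 := by
      have h2 : HasDerivAt (fun t : ℝ => x + t • y) y 0 := by
        simpa using ((hasDerivAt_id (0 : ℝ)).smul_const y).const_add x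
      have h3 : HasFDerivAt N L (x + (0 : ℝ) • y) := by simpa using hL
      exact h3.comp_hasDerivAt 0 h2
    have h4 := h1.tendsto_slope_zero_right.eventually (gt_mem_nhds (lt_add_of_pos_right (L y) hε))
    obtain ⟨t, ht, ht0⟩ := (h4.and self_mem_nhdsWithin).exists
    have ht0 : 0 < t := ht0
    simp only [zero_add, zero_smul, add_zero, smul_eq_mul] at ht
    have h5 : Filter.Tendsto (fun k => t⁻¹ * (M k (x + t • y) - M k x)) l
        (𝓝 (t⁻¹ * (N (x + t • y) - N x))) := ((hN _).sub (hN _)).const_mul _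
    filter_upwards [h5.eventually (gt_mem_nhds ht)] with k hk
    refine lt_of_le_of_lt ?_ hk
    have := (h k).fderiv_le_sub (hL' k) (t • y)
    rw [map_smul, smul_eq_mul] at this
    rw [← div_eq_inv_mul, le_div_iff₀ ht0]
    linarith
  have hpt : ∀ y, Filter.Tendsto (fun k => L' k y) l (𝓝 (L y)) := by
    intro y
    rw [Metric.tendsto_nhds]
    intro ε hε
    filter_upwards [hup y ε hε, hup (-y) ε hε] with k h1 h2
    rw [map_neg, map_neg] at h2
    rw [Real.dist_eq, abs_lt]
    constructor <;> linarith
  have hrep : ∀ T : W →L[ℝ] ℝ, T = ∑ i, T (stdOrthonormalBasis ℝ W i) •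
      innerSL ℝ (stdOrthonormalBasis ℝ W i) := by
    intro T
    ext y
    conv_lhs => rw [← (stdOrthonormalBasis ℝ W).sum_repr' y]
    simp [mul_comm]
  rw [hrep L, funext fun k => hrep (L' k)]
  exact tendsto_finsetSum _ fun i _ => (hpt _).smul_const _

end IsGauge

/-! ### Radial projection charts of the boundary. -/

section Charts

variable {W : Type*} [NormedAddCommGroup W] [InnerProductSpace ℝ W] [FiniteDimensional ℝ W]
  [MeasurableSpace W] [BorelSpace W]
  {r R : ℝ} {N : W → ℝ} {a e : W}

/-- The chart of the boundary of `gaugeBody N a` obtained by radial projection, with center `a`,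
from the hyperplane through `a + e` orthogonal to `e`. -/
noncomputable def gaugeChart (N : W → ℝ) (a e : W) (u : (ℝ ∙ e)ᗮ) : W :=
  a + (N (e + u))⁻¹ • (e + u)

/-- The derivative of `gaugeChart`. -/
noncomputable def gaugeChartDeriv (N : W → ℝ) (e : W) (u : (ℝ ∙ e)ᗮ) : (ℝ ∙ e)ᗮ →L[ℝ] W :=
  (N (e + u))⁻¹ • (ℝ ∙ e)ᗮ.subtypeL -
    (N (e + u) ^ 2)⁻¹ • ((fderiv ℝ N (e + u)).comp (ℝ ∙ e)ᗮ.subtypeL).smulRight (e + (u : W))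

theorem inner_orthogonal_singleton (e : W) (u : (ℝ ∙ e)ᗮ) : inner ℝ (u : W) e = 0 :=
  Submodule.mem_orthogonal_singleton_iff_inner_left.1 u.2

theorem inner_add_orthogonal (he : ‖e‖ = 1) (u : (ℝ ∙ e)ᗮ) : inner ℝ (e + u : W) e = 1 := by
  rw [inner_add_left, inner_orthogonal_singleton, real_inner_self_eq_norm_sq, he]
  norm_num

theorem one_le_norm_add_orthogonal (he : ‖e‖ = 1) (u : (ℝ ∙ e)ᗮ) : 1 ≤ ‖e + (u : W)‖ := by
  have h := real_inner_le_norm (e + u : W) e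
  rw [inner_add_orthogonal he, he, mul_one] at h
  exact h

theorem add_orthogonal_ne_zero (he : ‖e‖ = 1) (u : (ℝ ∙ e)ᗮ) : e + (u : W) ≠ 0 :=
  norm_pos_iff.1 (one_pos.trans_le (one_le_norm_add_orthogonal he u))

namespace IsGauge

theorem inv_le (h : IsGauge r R N) (he : ‖e‖ = 1) (u : (ℝ ∙ e)ᗮ) : (N (e + u))⁻¹ ≤ R := by
  have h1 := h.pos (add_orthogonal_ne_zero he u)
  rw [inv_le_iff_one_le_mul₀ h1]
  exact (one_le_norm_add_orthogonal he u).trans (h.lower _)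

theorem apply_gaugeChart (h : IsGauge r R N) (he : ‖e‖ = 1) (u : (ℝ ∙ e)ᗮ) :
    N (gaugeChart N a e u - a) = 1 := by
  have h1 := h.pos (add_orthogonal_ne_zero he u)
  rw [gaugeChart, add_sub_cancel_left, h.smul _ (inv_nonneg.2 h1.le), inv_mul_cancel₀ h1.ne']

/-- The difference splits into a change of direction, with factor `1 / N ≤ R`, and a change of
scale, with factor `R * r⁻¹ * R` from the Lipschitz constant `r⁻¹` of `N`. -/
theorem lipschitzWith_gaugeChart (h : IsGauge r R N) (he : ‖e‖ = 1) :
    LipschitzWith (R + R * R / r).toNNReal (gaugeChart N a e) := by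
  refine LipschitzWith.of_dist_le_mul fun u v => ?_
  have hR := h.R_pos
  have hr := h.r_pos
  rw [Real.coe_toNNReal _ (by positivity), dist_eq_norm, dist_eq_norm, gaugeChart, gaugeChart]
  have h1 := h.pos (add_orthogonal_ne_zero he u)
  have h2 := h.pos (add_orthogonal_ne_zero he v)
  have h3 := h.inv_le he u
  have h4 := h.lower (e + v)
  have h5 : |N (e + u) - N (e + v)| ≤ r⁻¹ * ‖u - v‖ := by
    have := h.lipschitzWith.dist_le_mul (e + u) (e + v)
    rw [Real.dist_eq, dist_eq_norm, Real.coe_toNNReal _ (by positivity), add_sub_add_left_eq_sub]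
      at this
    exact this
  have h6 : a + (N (e + u))⁻¹ • (e + (u : W)) - (a + (N (e + v))⁻¹ • (e + (v : W))) =
      (N (e + u))⁻¹ • ((u : W) - v) +
        ((N (e + u))⁻¹ * (N (e + v))⁻¹ * (N (e + v) - N (e + u))) • (e + (v : W)) := by
    have : (N (e + u))⁻¹ * (N (e + v))⁻¹ * (N (e + v) - N (e + u)) =
        (N (e + u))⁻¹ - (N (e + v))⁻¹ := by field_simp
    rw [this]
    module
  rw [h6]
  refine (norm_add_le _ _).trans ?_
  rw [norm_smul, norm_smul, norm_mul, norm_mul, norm_inv, norm_inv, Real.norm_of_nonneg h1.le,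
    Real.norm_of_nonneg h2.le, Real.norm_eq_abs, abs_sub_comm]
  have h7 : ‖(u : W) - v‖ = ‖u - v‖ := rfl
  have h8 : (N (e + v))⁻¹ * ‖e + (v : W)‖ ≤ R := by
    rw [inv_mul_le_iff₀ h2]
    linarith
  have h9 : (N (e + u))⁻¹ * (N (e + v))⁻¹ * |N (e + u) - N (e + v)| * ‖e + (v : W)‖ ≤
      R * (r⁻¹ * ‖u - v‖) * R := by
    calc _ = ((N (e + u))⁻¹ * |N (e + u) - N (e + v)|) * ((N (e + v))⁻¹ * ‖e + (v : W)‖) := by ring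
      _ ≤ _ := by gcongr
  have h10 : (N (e + u))⁻¹ * ‖(u : W) - v‖ ≤ R * ‖u - v‖ := by
    rw [h7]; gcongr
  calc _ ≤ R * ‖u - v‖ + R * (r⁻¹ * ‖u - v‖) * R := add_le_add h10 h9
    _ = _ := by rw [div_eq_mul_inv]; ring

theorem injective_gaugeChart (h : IsGauge r R N) (he : ‖e‖ = 1) :
    Function.Injective (gaugeChart N a e) := by
  intro u v huv
  rw [gaugeChart, gaugeChart, add_right_inj] at huv
  have h1 := congrArg (fun w => inner ℝ w e) huv
  simp only [inner_smul_left, inner_add_orthogonal he, conj_trivial, mul_one] at h1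
  rw [h1] at huv
  have h2 := h.pos (add_orthogonal_ne_zero he v)
  have h3 := smul_right_injective W (inv_ne_zero h2.ne') huv
  exact Subtype.ext (add_left_cancel h3)

theorem hasFDerivAt_gaugeChart (h : IsGauge r R N) (he : ‖e‖ = 1) {u : (ℝ ∙ e)ᗮ}
    (hN : DifferentiableAt ℝ N (e + u)) :
    HasFDerivAt (gaugeChart N a e) (gaugeChartDeriv N e u) u := by
  have h1 := h.pos (add_orthogonal_ne_zero he u)
  have hp : HasFDerivAt (fun v : (ℝ ∙ e)ᗮ => e + (v : W)) (ℝ ∙ e)ᗮ.subtypeL u :=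
    ((ℝ ∙ e)ᗮ.subtypeL.hasFDerivAt).const_add e
  have hNp : HasFDerivAt (fun v : (ℝ ∙ e)ᗮ => N (e + (v : W)))
      ((fderiv ℝ N (e + u)).comp (ℝ ∙ e)ᗮ.subtypeL) u :=
    HasFDerivAt.comp (g := N) u hN.hasFDerivAt hp
  have hi : HasFDerivAt (fun v : (ℝ ∙ e)ᗮ => (N (e + (v : W)))⁻¹)
      (-(N (e + u) ^ 2)⁻¹ • ((fderiv ℝ N (e + u)).comp (ℝ ∙ e)ᗮ.subtypeL)) u :=
    (hasDerivAt_inv h1.ne').comp_hasFDerivAt u hNp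
  have := (hi.smul hp).const_add a
  refine this.congr_fderiv ?_
  ext v
  simp only [gaugeChartDeriv, add_apply, sub_apply, smul_apply, Submodule.subtypeL_apply,
    ContinuousLinearMap.smulRight_apply, ContinuousLinearMap.comp_apply, smul_eq_mul]
  module

/-- Pairing a kernel equation with `e` isolates the coefficient of `e + u`, which therefore
vanishes; what remains is a nonzero multiple of `v`. -/
theorem injective_gaugeChartDeriv (h : IsGauge r R N) (he : ‖e‖ = 1) (u : (ℝ ∙ e)ᗮ) :
    Function.Injective (gaugeChartDeriv N e u) := by
  have h1 := h.pos (add_orthogonal_ne_zero he u)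
  rw [injective_iff_map_eq_zero]
  intro v hv
  simp only [gaugeChartDeriv, sub_apply, smul_apply, Submodule.subtypeL_apply,
    ContinuousLinearMap.smulRight_apply, ContinuousLinearMap.comp_apply] at hv
  have h2 := congrArg (fun w => inner ℝ w e) hv
  simp only [inner_sub_left, inner_smul_left, inner_add_orthogonal he, conj_trivial, mul_one,
    inner_orthogonal_singleton, mul_zero, inner_zero_left, zero_sub, neg_eq_zero] at h2
  rw [smul_smul, h2, zero_smul, sub_zero] at hv
  exact Subtype.ext ((smul_eq_zero.1 hv).resolve_left (inv_ne_zero h1.ne'))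

/-- Rademacher in the whole space says nothing about a hyperplane, which is null. It is applied to
the restriction of `N` to `e + eᗮ`, and homogeneity, `N x = ⟨x, e⟩ * N (e + P x / ⟨x, e⟩)` for `⟨x,
e⟩ > 0`, extends differentiability to a full neighbourhood. -/
theorem ae_differentiableAt (h : IsGauge r R N) (he : ‖e‖ = 1) :
    ∀ᵐ u : (ℝ ∙ e)ᗮ, DifferentiableAt ℝ N (e + u) := by
  have hl : LipschitzWith ((r⁻¹).toNNReal * 1) fun u : (ℝ ∙ e)ᗮ => N (e + (u : W)) := by
    refine h.lipschitzWith.comp (LipschitzWith.of_dist_le_mul fun u v => ?_)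
    simp only [NNReal.coe_one, one_mul, dist_add_left]
    exact le_rfl
  filter_upwards [hl.ae_differentiableAt (μ := volume)] with u hu
  set P := (ℝ ∙ e)ᗮ.orthogonalProjectionOnto with hP
  have hPe : P e = 0 := by
    simp [hP]
  have hPu : P (e + u) = u := by
    rw [map_add, hPe, zero_add, hP, Submodule.orthogonalProjectionOnto_mem_subspace_eq_self]
  have hie : inner ℝ (e + u : W) e = 1 := inner_add_orthogonal he u
  have hdi : DifferentiableAt ℝ (fun x : W => inner ℝ x e) (e + u) :=
    differentiableAt_id.inner ℝ (differentiableAt_const e)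
  have hcoord : DifferentiableAt ℝ (fun x : W => (inner ℝ x e)⁻¹ • P x) (e + u) :=
    (hdi.inv (by rw [hie]; exact one_ne_zero)).smul P.differentiableAt
  have hu' : DifferentiableAt ℝ (fun u : (ℝ ∙ e)ᗮ => N (e + (u : W)))
      ((inner ℝ (e + u : W) e)⁻¹ • P (e + u)) := by
    rw [hie, hPu, inv_one, one_smul]
    exact hu
  have hcomp := hdi.mul (DifferentiableAt.comp (e + (u : W)) hu' hcoord)
  refine hcomp.congr_of_eventuallyEq ?_
  have hpos : ∀ᶠ x in 𝓝 (e + (u : W)), 0 < inner ℝ x e :=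
    hdi.continuousAt.eventually (lt_mem_nhds (show (0 : ℝ) < inner ℝ (e + (u : W)) e by rw [hie]; exact one_pos))
  filter_upwards [hpos] with x hx
  simp only [Function.comp, Pi.mul_apply]
  rw [← h.smul _ hx.le]
  congr 1
  rw [Submodule.coe_smul, smul_add, smul_inv_smul₀ hx.ne']
  have h3 := (ℝ ∙ e).starProjection_add_starProjection_orthogonal x
  rw [Submodule.starProjection_unit_singleton ℝ he, real_inner_comm] at h3
  exact h3.symm

theorem norm_gaugeChartDeriv_le (h : IsGauge r R N) (he : ‖e‖ = 1) {u : (ℝ ∙ e)ᗮ}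
    (hN : DifferentiableAt ℝ N (e + u)) : ‖gaugeChartDeriv N e u‖ ≤ R + R * R / r := by
  have hR := h.R_pos
  have hr := h.r_pos
  have := (h.hasFDerivAt_gaugeChart (a := 0) he hN).le_of_lipschitz (h.lipschitzWith_gaugeChart he)
  rwa [Real.coe_toNNReal _ (by positivity)] at this

theorem measurable_gaugeChartDeriv (h : IsGauge r R N) : Measurable (gaugeChartDeriv N e) := by
  have hp : Measurable fun u : (ℝ ∙ e)ᗮ => e + (u : W) := by fun_prop
  have hN : Measurable fun u : (ℝ ∙ e)ᗮ => N (e + (u : W)) := h.continuous.measurable.comp hp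
  have hD : Measurable fun u : (ℝ ∙ e)ᗮ => fderiv ℝ N (e + (u : W)) :=
    (measurable_fderiv ℝ N).comp hp
  have hc : Continuous fun q : (W →L[ℝ] ℝ) × W =>
      (q.1.comp (ℝ ∙ e)ᗮ.subtypeL).smulRight q.2 := by
    have h2 : Continuous fun q : (W →L[ℝ] ℝ) × W => q.1.comp (ℝ ∙ e)ᗮ.subtypeL := by fun_prop
    exact (ContinuousLinearMap.smulRightL ℝ (ℝ ∙ e)ᗮ W).continuous₂.comp
      (h2.prodMk continuous_snd)
  refine (hN.inv.smul_const _).sub ((hN.pow_const 2).inv.smul ?_)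
  exact hc.measurable.comp (hD.prodMk hp)

end IsGauge

end Charts

/-! ### Boundary integrals as finite sums of integrals over fixed domains. -/

section BoundaryIntegral

variable {W : Type*} [NormedAddCommGroup W] [InnerProductSpace ℝ W] [FiniteDimensional ℝ W]

/-- A finite partition of the complement of the origin into measurable cones, each of them lying
in a circular cone of opening less than `π / 2`. -/
structure ConePartition (W : Type*) [NormedAddCommGroup W] [InnerProductSpace ℝ W]
    [MeasurableSpace W] where
  card : ℕ
  axis : Fin card → W
  cone : Fin card → Set W
  slope : ℝ
  slope_pos : 0 < slope
  norm_axis : ∀ j, ‖axis j‖ = 1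
  measurableSet_cone : ∀ j, MeasurableSet (cone j)
  smul_mem : ∀ j, ∀ x ∈ cone j, ∀ t : ℝ, 0 < t → t • x ∈ cone j
  ne_zero : ∀ j, ∀ x ∈ cone j, x ≠ 0
  slope_le : ∀ j, ∀ x ∈ cone j, slope * ‖x‖ ≤ inner ℝ x (axis j)
  disjoint : Pairwise (Function.onFun Disjoint cone)
  exists_mem : ∀ x, x ≠ 0 → ∃ j, x ∈ cone j

theorem nonempty_conePartition [MeasurableSpace W] [BorelSpace W] : Nonempty (ConePartition W) := by
  classical
  set d := finrank ℝ W with hd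
  let b := stdOrthonormalBasis ℝ W
  let E : Fin d × Bool ≃ Fin (Fintype.card (Fin d × Bool)) := Fintype.equivFin _
  let e : Fin (Fintype.card (Fin d × Bool)) → W := fun j =>
    if (E.symm j).2 then b (E.symm j).1 else -b (E.symm j).1
  -- The axes are plus and minus an orthonormal basis. If every `⟨x, e j⟩` were below `c * ‖x‖`,
  -- then `‖x‖` would be at most `d * c * ‖x‖ < ‖x‖`. Assigning `x` to the first admissible index
  -- makes the cones disjoint.
  set c : ℝ := (d + 1 : ℝ)⁻¹ with hc
  have hc0 : 0 < c := by positivity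
  refine ⟨⟨_, e, fun j => {x | x ≠ 0 ∧ c * ‖x‖ ≤ inner ℝ x (e j) ∧
    ∀ i < j, inner ℝ x (e i) < c * ‖x‖}, c, hc0, fun j => ?_, fun j => ?_, fun j x hx t ht => ?_,
    fun j x hx => hx.1, fun j x hx => hx.2.1, fun i j hij => ?_, fun x hx => ?_⟩⟩
  · simp only [e]
    split_ifs <;> simp [b.norm_eq_one]
  · have h1 : ∀ i, Measurable fun x : W => inner ℝ x (e i) := fun i =>
      (continuous_id.inner continuous_const).measurable
    have h2 : Measurable fun x : W => c * ‖x‖ := measurable_norm.const_mul c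
    have h3 : {x : W | ∀ i < j, inner ℝ x (e i) < c * ‖x‖} =
        ⋂ i, ⋂ (_ : i < j), {x : W | inner ℝ x (e i) < c * ‖x‖} := by
      ext; simp
    have h4 : MeasurableSet {x : W | ∀ i < j, inner ℝ x (e i) < c * ‖x‖} := by
      rw [h3]
      exact MeasurableSet.iInter fun i => MeasurableSet.iInter fun _ => measurableSet_lt (h1 i) h2
    exact (measurableSet_singleton (0 : W)).compl.inter ((measurableSet_le h2 (h1 j)).inter h4)
  · obtain ⟨h1, h2, h3⟩ := hx
    refine ⟨smul_ne_zero ht.ne' h1, ?_, fun i hi => ?_⟩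
    · rw [inner_smul_left, norm_smul, Real.norm_of_nonneg ht.le, conj_trivial, mul_left_comm]
      gcongr
    · rw [inner_smul_left, norm_smul, Real.norm_of_nonneg ht.le, conj_trivial, mul_left_comm]
      exact mul_lt_mul_of_pos_left (h3 i hi) ht
  · rw [Function.onFun, disjoint_left]
    rintro x ⟨-, h1, h2⟩ ⟨-, h3, h4⟩
    rcases hij.lt_or_gt with h | h
    · exact absurd h1 (not_le.2 (h4 i h))
    · exact absurd h3 (not_le.2 (h2 j h))
  · have hex : ∃ j, c * ‖x‖ ≤ inner ℝ x (e j) := by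
      by_contra! hcon
      have h1 : ∀ i, |inner ℝ (b i) x| ≤ c * ‖x‖ := by
        intro i
        have h1 := hcon (E (i, true))
        have h2 := hcon (E (i, false))
        simp only [e, Equiv.symm_apply_apply, if_true, inner_neg_right, Bool.false_eq_true,
          if_false] at h1 h2
        rw [real_inner_comm, abs_le]
        constructor <;> linarith
      have h2 : ‖x‖ ≤ ∑ i : Fin d, c * ‖x‖ := by
        calc ‖x‖ = ‖∑ i, inner ℝ (b i) x • b i‖ := by rw [b.sum_repr' x]
          _ ≤ ∑ i, ‖inner ℝ (b i) x • b i‖ := norm_sum_le _ _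
          _ ≤ ∑ i : Fin d, c * ‖x‖ := by
            refine Finset.sum_le_sum fun i _ => ?_
            rw [norm_smul, b.norm_eq_one, mul_one]
            exact h1 i
      rw [Finset.sum_const, Finset.card_univ, Fintype.card_fin, nsmul_eq_mul] at h2
      have h3 : c * (d + 1) = 1 := inv_mul_cancel₀ (by positivity)
      have h4 : 0 < c * ‖x‖ := mul_pos hc0 (norm_pos_iff.2 hx)
      nlinarith
    set S := Finset.univ.filter fun j => c * ‖x‖ ≤ inner ℝ x (e j) with hS
    have hSne : S.Nonempty := by
      obtain ⟨j, hj⟩ := hex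
      exact ⟨j, by simp [hS, hj]⟩
    have hmem := S.min'_mem hSne
    refine ⟨S.min' hSne, hx, by simpa [hS] using hmem, fun i hi => ?_⟩
    by_contra! hcon
    exact absurd (S.min'_le i (by simp [hS, hcon])) (not_le.2 hi)

/-- The part of the hyperplane used in the chart with index `j`. -/
def ConePartition.base [MeasurableSpace W] (P : ConePartition W) (j : Fin P.card) :
    Set (ℝ ∙ P.axis j)ᗮ :=
  {u | P.axis j + (u : W) ∈ P.cone j}

variable [MeasurableSpace W] [BorelSpace W] {r R : ℝ} {N : W → ℝ} {a e : W}

namespace ConePartition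

theorem measurableSet_base (P : ConePartition W) (j : Fin P.card) : MeasurableSet (P.base j) :=
  (P.measurableSet_cone j).preimage
    (show Measurable fun u : (ℝ ∙ P.axis j)ᗮ => P.axis j + (u : W) by fun_prop)

/-- On the base `⟨e + u, e⟩ = 1`, so the slope condition bounds `‖e + u‖`. Hence the chart domains
have finite volume, as dominated convergence requires. -/
theorem base_subset (P : ConePartition W) (j : Fin P.card) :
    P.base j ⊆ Metric.closedBall 0 (P.slope⁻¹ + 1) := by
  intro u hu
  have h1 := P.slope_le j _ hu
  rw [inner_add_orthogonal (P.norm_axis j), ← le_div_iff₀' P.slope_pos, one_div] at h1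
  have h2 : ‖(u : W)‖ ≤ ‖P.axis j + (u : W)‖ + ‖P.axis j‖ := by
    simpa using norm_sub_le (P.axis j + (u : W)) (P.axis j)
  rw [P.norm_axis] at h2
  rw [mem_closedBall_zero_iff]
  change ‖(u : W)‖ ≤ _
  linarith

theorem volume_base_lt_top (P : ConePartition W) (j : Fin P.card) : volume (P.base j) < ∞ :=
  (measure_mono (P.base_subset j)).trans_lt measure_closedBall_lt_top

theorem image_base (P : ConePartition W) (j : Fin P.card) (h : IsGauge r R N) :
    gaugeChart N a (P.axis j) '' P.base j = {x | N (x - a) = 1 ∧ x - a ∈ P.cone j} := by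
  set e := P.axis j with he'
  have he : ‖e‖ = 1 := P.norm_axis j
  ext x
  constructor
  · rintro ⟨u, hu, rfl⟩
    refine ⟨h.apply_gaugeChart he u, ?_⟩
    rw [gaugeChart, add_sub_cancel_left]
    exact P.smul_mem j _ hu _ (inv_pos.2 (h.pos (add_orthogonal_ne_zero he u)))
  · rintro ⟨hx1, hx2⟩
    set v := x - a with hv
    set i := inner ℝ v e with hi
    have hi0 : 0 < i := lt_of_lt_of_le
      (mul_pos P.slope_pos (norm_pos_iff.2 (P.ne_zero j v hx2))) (P.slope_le j v hx2)
    set u : (ℝ ∙ e)ᗮ := i⁻¹ • (ℝ ∙ e)ᗮ.orthogonalProjectionOnto v with hu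
    have heu : e + (u : W) = i⁻¹ • v := by
      have h3 := (ℝ ∙ e).starProjection_add_starProjection_orthogonal v
      rw [Submodule.starProjection_unit_singleton ℝ he, real_inner_comm] at h3
      conv_rhs => rw [← h3]
      rw [smul_add, inv_smul_smul₀ hi0.ne', hu, Submodule.coe_smul]
      rfl
    refine ⟨u, ?_, ?_⟩
    · change e + (u : W) ∈ P.cone j
      rw [heu]
      exact P.smul_mem j _ hx2 _ (inv_pos.2 hi0)
    · rw [gaugeChart, heu, h.smul _ (inv_pos.2 hi0).le, hx1, mul_one, inv_inv,
        smul_inv_smul₀ hi0.ne', hv, add_sub_cancel]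

theorem frontier_eq_iUnion (P : ConePartition W) (h : IsGauge r R N) :
    frontier (gaugeBody N a) = ⋃ j, gaugeChart N a (P.axis j) '' P.base j := by
  rw [h.frontier_gaugeBody]
  ext x
  simp only [P.image_base _ h, mem_iUnion, mem_ofPred_eq, exists_and_left]
  refine ⟨fun hx => ⟨hx, P.exists_mem _ fun h0 => ?_⟩, fun hx => hx.1⟩
  rw [h0, h.zero] at hx
  exact zero_ne_one hx

end ConePartition

namespace IsGauge

theorem image_not_differentiableAt_null (h : IsGauge r R N) (he : ‖e‖ = 1) :
    μHE[finrank ℝ (ℝ ∙ e)ᗮ]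
      (gaugeChart N a e '' {u | ¬ DifferentiableAt ℝ N (e + (u : W))}) = 0 := by
  have h1 := ((h.lipschitzWith_gaugeChart (a := a) he).lipschitzOnWith
    (s := {u : (ℝ ∙ e)ᗮ | ¬ DifferentiableAt ℝ N (e + (u : W))})).euclideanHausdorffMeasure_image_le
    (finrank ℝ (ℝ ∙ e)ᗮ)
  have h2 : volume {u : (ℝ ∙ e)ᗮ | ¬ DifferentiableAt ℝ N (e + (u : W))} = 0 :=
    ae_iff.1 (h.ae_differentiableAt he)
  rw [InnerProductSpace.euclideanHausdorffMeasure_eq_volume, h2, mul_zero] at h1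
  exact le_antisymm h1 zero_le

theorem setIntegral_image_gaugeChart (h : IsGauge r R N) (he : ‖e‖ = 1) {B : Set (ℝ ∙ e)ᗮ}
    (hB : MeasurableSet B) {g : W → ℝ} (hg : Measurable g) :
    ∫ x in gaugeChart N a e '' B, g x ∂μHE[finrank ℝ (ℝ ∙ e)ᗮ] =
      ∫ u in B, (gaugeChartDeriv N e u : (ℝ ∙ e)ᗮ →ₗ[ℝ] W).normDet * g (gaugeChart N a e u) := by
  set D : Set (ℝ ∙ e)ᗮ := {u | DifferentiableAt ℝ N (e + (u : W))} with hD
  have hDm : MeasurableSet D := (measurableSet_of_differentiableAt ℝ N).preimage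
    (show Measurable fun u : (ℝ ∙ e)ᗮ => e + (u : W) by fun_prop)
  have h1 : (gaugeChart N a e '' B : Set W) =ᵐ[μHE[finrank ℝ (ℝ ∙ e)ᗮ]]
      (gaugeChart N a e '' (B ∩ D) : Set W) := by
    have : gaugeChart N a e '' B =
        gaugeChart N a e '' (B ∩ D) ∪ gaugeChart N a e '' (B \ D) := by
      rw [← image_union, inter_union_sdiff]
    rw [this]
    refine union_ae_eq_left_of_ae_eq_empty (ae_eq_empty.2 ?_)
    refine measure_mono_null (image_mono ?_) (h.image_not_differentiableAt_null (a := a) he)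
    exact fun u hu => hu.2
  have h2 : B =ᵐ[volume] (B ∩ D : Set (ℝ ∙ e)ᗮ) := by
    filter_upwards [h.ae_differentiableAt he] with u hu
    have huD : u ∈ D := hu
    have : (u ∈ B) = (u ∈ B ∩ D) := by simp [huD]
    exact this
  rw [setIntegral_congr_set h1, setIntegral_congr_set h2]
  exact integral_image_eq_integral_normDet_mul (hB.inter hDm)
    (fun u hu => (h.hasFDerivAt_gaugeChart he hu.2).hasFDerivWithinAt)
    ((h.injective_gaugeChart he).injOn) (fun u _ => h.injective_gaugeChartDeriv he u)
    h.measurable_gaugeChartDeriv (h.lipschitzWith_gaugeChart he).continuous.measurable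
    hg.aestronglyMeasurable

variable {d : ℕ}

theorem finrank_orthogonal_axis (hd : finrank ℝ W = d + 1) (he : ‖e‖ = 1) :
    finrank ℝ (ℝ ∙ e)ᗮ = d := by
  have : Fact (finrank ℝ W = d + 1) := ⟨hd⟩
  exact Submodule.finrank_orthogonal_span_singleton (norm_pos_iff.1 (he ▸ one_pos))

/-- Differentiability is invariant along rays, so the exceptional boundary points are Lipschitz
images of the null exceptional sets in the hyperplanes. -/
theorem ae_frontier_differentiableAt (h : IsGauge r R N) (hd : finrank ℝ W = d + 1) :
    ∀ᵐ x ∂(μHE[d].restrict (frontier (gaugeBody N a))),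
      N (x - a) = 1 ∧ DifferentiableAt ℝ N (x - a) := by
  have hm : MeasurableSet {x : W | N (x - a) = 1 ∧ DifferentiableAt ℝ N (x - a)} := by
    refine MeasurableSet.inter ?_ ?_
    · exact (measurableSet_singleton (1 : ℝ)).preimage
        (h.continuous.measurable.comp (measurable_id.sub_const a))
    · exact (measurableSet_of_differentiableAt ℝ N).preimage (measurable_id.sub_const a)
  rw [ae_restrict_iff hm, ae_iff]
  obtain ⟨P⟩ := nonempty_conePartition (W := W)
  refine measure_mono_null (t := ⋃ j, gaugeChart N a (P.axis j) ''
    {u | ¬ DifferentiableAt ℝ N (P.axis j + (u : W))}) ?_ ?_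
  · intro x hx
    simp only [mem_ofPred_eq, Classical.not_imp, not_and] at hx
    obtain ⟨hx1, hx2⟩ := hx
    have hx3 : N (x - a) = 1 := by rwa [h.frontier_gaugeBody] at hx1
    rw [P.frontier_eq_iUnion h] at hx1
    obtain ⟨j, u, hu, rfl⟩ := mem_iUnion.1 hx1
    refine mem_iUnion.2 ⟨j, u, fun hN => hx2 hx3 ?_, rfl⟩
    rw [gaugeChart, add_sub_cancel_left]
    exact (h.hasFDerivAt_smul hN.hasFDerivAt (inv_pos.2
      (h.pos (add_orthogonal_ne_zero (P.norm_axis j) u)))).differentiableAt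
  · refine measure_iUnion_null fun j => ?_
    have := h.image_not_differentiableAt_null (a := a) (P.norm_axis j)
    rwa [finrank_orthogonal_axis hd (P.norm_axis j)] at this

theorem measure_frontier_lt_top (h : IsGauge r R N) (hd : finrank ℝ W = d + 1) :
    μHE[d] (frontier (gaugeBody N a)) < ∞ := by
  obtain ⟨P⟩ := nonempty_conePartition (W := W)
  rw [P.frontier_eq_iUnion h]
  refine (measure_iUnion_le _).trans_lt ?_
  rw [tsum_fintype]
  refine ENNReal.sum_lt_top.2 fun j _ => ?_
  have h1 := ((h.lipschitzWith_gaugeChart (a := a) (P.norm_axis j)).lipschitzOnWith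
    (s := P.base j)).euclideanHausdorffMeasure_image_le (finrank ℝ (ℝ ∙ P.axis j)ᗮ)
  rw [InnerProductSpace.euclideanHausdorffMeasure_eq_volume,
    finrank_orthogonal_axis hd (P.norm_axis j)] at h1
  exact h1.trans_lt (ENNReal.mul_lt_top (by simp) (P.volume_base_lt_top j))

theorem measurable_normalizedGradient (N : W → ℝ) :
    Measurable fun v => ‖gradient N v‖⁻¹ • gradient N v := by
  have h : Measurable (gradient N) :=
    (InnerProductSpace.toDual ℝ W).symm.continuous.measurable.comp (measurable_fderiv ℝ N)
  exact h.norm.inv.smul h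

theorem norm_normalizedGradient_le (N : W → ℝ) (v : W) :
    ‖‖gradient N v‖⁻¹ • gradient N v‖ ≤ 1 := by
  rw [norm_smul, norm_inv, norm_norm]
  exact inv_mul_le_one

theorem integrableOn_frontier (h : IsGauge r R N) (hd : finrank ℝ W = d + 1) {Φ : W × W → ℝ}
    (hΦ : Continuous Φ) :
    IntegrableOn (fun x => Φ (x, ‖gradient N (x - a)‖⁻¹ • gradient N (x - a)))
      (frontier (gaugeBody N a)) μHE[d] := by
  have hK : IsCompact (Metric.closedBall a R ×ˢ Metric.closedBall (0 : W) 1) :=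
    (isCompact_closedBall _ _).prod (isCompact_closedBall _ _)
  obtain ⟨C, hC⟩ := hK.exists_bound_of_continuousOn hΦ.continuousOn
  have hm : Measurable fun x => Φ (x, ‖gradient N (x - a)‖⁻¹ • gradient N (x - a)) :=
    hΦ.measurable.comp (measurable_id.prodMk
      ((measurable_normalizedGradient N).comp (measurable_id.sub_const a)))
  refine IntegrableOn.of_bound (h.measure_frontier_lt_top hd) hm.aestronglyMeasurable C ?_
  refine (ae_restrict_iff' isClosed_frontier.measurableSet).2 (Filter.Eventually.of_forall ?_)
  intro x hx
  refine hC _ ⟨?_, ?_⟩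
  · rw [h.frontier_gaugeBody] at hx
    have := h.lower (x - a)
    rw [show N (x - a) = 1 from hx, mul_one] at this
    rwa [Metric.mem_closedBall, dist_eq_norm]
  · rw [mem_closedBall_zero_iff]
    exact norm_normalizedGradient_le N _

/-- The domains `P.base j` depend only on the partition and not on the gauge, which is what allows
passing to the limit under the integral. -/
theorem setIntegral_frontier (h : IsGauge r R N) (hd : finrank ℝ W = d + 1)
    (P : ConePartition W) {Φ : W × W → ℝ} (hΦ : Continuous Φ) :
    ∫ x in frontier (gaugeBody N a),
        Φ (x, ‖gradient N (x - a)‖⁻¹ • gradient N (x - a)) ∂μHE[d] =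
      ∑ j, ∫ u in P.base j, (gaugeChartDeriv N (P.axis j) u).toLinearMap.normDet *
        Φ (gaugeChart N a (P.axis j) u,
          ‖gradient N (P.axis j + u)‖⁻¹ • gradient N (P.axis j + u)) := by
  have hint := h.integrableOn_frontier (a := a) hd hΦ
  have hmeas : ∀ j, MeasurableSet (gaugeChart N a (P.axis j) '' P.base j) := fun j =>
    (P.measurableSet_base j).image_of_continuousOn_injOn
      (h.lipschitzWith_gaugeChart (P.norm_axis j)).continuous.continuousOn
      (h.injective_gaugeChart (P.norm_axis j)).injOn
  have hdisj : Pairwise (Function.onFun Disjoint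
      fun j => gaugeChart N a (P.axis j) '' P.base j) := by
    intro i j hij
    simp only [Function.onFun, P.image_base _ h, disjoint_left]
    exact fun x hx hy => disjoint_left.1 (P.disjoint hij) hx.2 hy.2
  rw [P.frontier_eq_iUnion h] at hint ⊢
  rw [integral_iUnion_fintype hmeas hdisj fun j => hint.mono_set
    (subset_iUnion (fun j => gaugeChart N a (P.axis j) '' P.base j) j)]
  refine Finset.sum_congr rfl fun j _ => ?_
  have hm : Measurable fun x => Φ (x, ‖gradient N (x - a)‖⁻¹ • gradient N (x - a)) :=
    hΦ.measurable.comp (measurable_id.prodMk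
      ((measurable_normalizedGradient N).comp (measurable_id.sub_const a)))
  have h1 := h.setIntegral_image_gaugeChart (a := a) (P.norm_axis j) (P.measurableSet_base j) hm
  rw [finrank_orthogonal_axis hd (P.norm_axis j)] at h1
  rw [h1]
  refine setIntegral_congr_ae (P.measurableSet_base j) ?_
  filter_upwards [h.ae_differentiableAt (P.norm_axis j)] with u hu _
  congr 3
  -- The gradient is homogeneous of degree 0, so it may be evaluated on the hyperplane instead of at
  -- the boundary point.
  have h2 : gradient N (gaugeChart N a (P.axis j) u - a) = gradient N (P.axis j + u) := by
    rw [gaugeChart, add_sub_cancel_left, gradient, gradient, (h.hasFDerivAt_smul hu.hasFDerivAt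
      (inv_pos.2 (h.pos (add_orthogonal_ne_zero (P.norm_axis j) u)))).fderiv]
  rw [h2]

end IsGauge

end BoundaryIntegral

/-! ### Compactness of gauges and continuity of volume and boundary integrals. -/

namespace IsGauge

variable {W : Type*} [NormedAddCommGroup W] [InnerProductSpace ℝ W] [FiniteDimensional ℝ W]
  {r R : ℝ}

/-- A form of Blaschke selection: compactness of a product of intervals gives convergence on a dense
sequence, and the common Lipschitz constant `r⁻¹` extends it to all points. -/
theorem exists_subseq_tendsto {M : ℕ → W → ℝ} (h : ∀ k, IsGauge r R (M k)) :
    ∃ φ : ℕ → ℕ, StrictMono φ ∧ ∃ N : W → ℝ, IsGauge r R N ∧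
      ∀ y, Filter.Tendsto (fun k => M (φ k) y) Filter.atTop (𝓝 (N y)) := by
  have hr := (h 0).r_pos
  have hR := (h 0).R_pos
  set D := TopologicalSpace.denseSeq W with hD
  have hK : IsCompact (Set.pi univ fun i => Icc (0 : ℝ) (‖D i‖ / r)) :=
    isCompact_univ_pi fun i => isCompact_Icc
  have hmem : ∀ k, (fun i => M k (D i)) ∈ Set.pi univ fun i => Icc (0 : ℝ) (‖D i‖ / r) := by
    intro k i _
    refine ⟨(h k).nonneg _, ?_⟩
    rw [le_div_iff₀ hr, mul_comm]
    exact (h k).upper _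
  obtain ⟨z, -, φ, hφ, hz⟩ := hK.tendsto_subseq hmem
  have hcauchy : ∀ y, CauchySeq fun k => M (φ k) y := by
    intro y
    rw [Metric.cauchySeq_iff]
    intro ε hε
    obtain ⟨i, hi⟩ := (TopologicalSpace.denseRange_denseSeq W).exists_dist_lt y
      (show 0 < ε / 4 * r by positivity)
    have hi' : ∀ k, dist (M k y) (M k (D i)) < ε / 4 := by
      intro k
      refine ((h k).lipschitzWith.dist_le_mul _ _).trans_lt ?_
      rw [Real.coe_toNNReal _ (by positivity), inv_mul_lt_iff₀ hr, mul_comm]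
      exact hi
    have hci : CauchySeq fun k => M (φ k) (D i) :=
      ((tendsto_pi_nhds.1 hz) i).cauchySeq
    obtain ⟨n, hn⟩ := Metric.cauchySeq_iff.1 hci (ε / 4) (by positivity)
    refine ⟨n, fun k hk l hl => ?_⟩
    have h1 := hn k hk l hl
    have h2 := hi' (φ k)
    have h3 := hi' (φ l)
    rw [dist_comm] at h3
    have h4 := dist_triangle4 (M (φ k) y) (M (φ k) (D i)) (M (φ l) (D i)) (M (φ l) y)
    linarith
  choose N hN using fun y => cauchySeq_tendsto_of_complete (hcauchy y)
  refine ⟨φ, hφ, N, ⟨hr, hR, fun x y => ?_, fun t ht x => ?_, fun x => ?_, fun x => ?_⟩, hN⟩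
  · exact le_of_tendsto_of_tendsto' (hN _) ((hN x).add (hN y)) fun k => (h _).add_le x y
  · refine tendsto_nhds_unique (hN _) (((hN x).const_mul t).congr fun k => ?_)
    exact ((h _).smul t ht x).symm
  · exact ge_of_tendsto' ((hN x).const_mul R) fun k => (h _).lower x
  · exact le_of_tendsto' ((hN x).const_mul r) fun k => (h _).upper x

variable {N : W → ℝ} {a : W} {M : ℕ → W → ℝ} {b : ℕ → W} {d : ℕ}

theorem tendsto_apply (h : ∀ k, IsGauge r R (M k))
    (hM : ∀ y, Filter.Tendsto (fun k => M k y) Filter.atTop (𝓝 (N y))) {y : ℕ → W} {z : W}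
    (hy : Filter.Tendsto y Filter.atTop (𝓝 z)) :
    Filter.Tendsto (fun k => M k (y k)) Filter.atTop (𝓝 (N z)) := by
  have hr := (h 0).r_pos
  have h1 : Filter.Tendsto (fun k => M k (y k) - M k z) Filter.atTop (𝓝 0) := by
    refine squeeze_zero_norm (a := fun k => r⁻¹ * ‖y k - z‖) (fun k => ?_) ?_
    · have := (h k).lipschitzWith.dist_le_mul (y k) z
      rwa [Real.coe_toNNReal _ (by positivity), dist_eq_norm, dist_eq_norm] at this
    · simpa using (tendsto_iff_norm_sub_tendsto_zero.1 hy).const_mul r⁻¹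
  simpa using h1.add (hM z)

variable [MeasurableSpace W] [BorelSpace W]

/-- The indicators converge off the boundary of the limit body, which is null by convexity, and
eventually all bodies lie in one ball. -/
theorem tendsto_volume (h : ∀ k, IsGauge r R (M k)) (hN : IsGauge r R N)
    (hM : ∀ y, Filter.Tendsto (fun k => M k y) Filter.atTop (𝓝 (N y)))
    (hb : Filter.Tendsto b Filter.atTop (𝓝 a)) :
    Filter.Tendsto (fun k => volume.real (gaugeBody (M k) (b k))) Filter.atTop
      (𝓝 (volume.real (gaugeBody N a))) := by
  have hfin : volume (Metric.ball a (R + 1)) ≠ ∞ := measure_ball_lt_top.ne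
  refine (ENNReal.tendsto_toReal ?_).comp ?_
  · exact (measure_mono (hN.gaugeBody_subset_ball.trans
      (Metric.ball_subset_ball (by linarith)))).trans_lt measure_ball_lt_top |>.ne
  refine tendsto_measure_of_ae_tendsto_indicator Filter.atTop hN.isOpen_gaugeBody.measurableSet
    (fun k => (h k).isOpen_gaugeBody.measurableSet) (B := Metric.ball a (R + 1))
    measurableSet_ball hfin ?_ ?_
  · filter_upwards [Metric.tendsto_nhds.1 hb 1 one_pos] with k hk
    refine (h k).gaugeBody_subset_ball.trans (Metric.ball_subset_ball' ?_)
    linarith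
  · have h0 : volume (frontier (gaugeBody N a)) = 0 :=
      hN.convex_gaugeBody.addHaar_frontier volume
    rw [hN.frontier_gaugeBody] at h0
    have h1 : ∀ᵐ x, ¬ N (x - a) = 1 := by
      rw [ae_iff]
      simpa using h0
    filter_upwards [h1] with x hx
    have h2 := tendsto_apply h hM (hb.const_sub x)
    rcases lt_or_gt_of_ne hx with h3 | h3
    · filter_upwards [h2.eventually (gt_mem_nhds h3)] with k hk
      exact ⟨fun _ => h3, fun _ => hk⟩
    · filter_upwards [h2.eventually (lt_mem_nhds h3)] with k hk
      exact ⟨fun h' => absurd (show M k (x - b k) < 1 from h') (not_lt.2 hk.le),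
        fun h' => absurd (show N (x - a) < 1 from h') (not_lt.2 h3.le)⟩

theorem tendsto_setIntegral_gaugeChart {e : W} (he : ‖e‖ = 1) (h : ∀ k, IsGauge r R (M k))
    (hN : IsGauge r R N)
    (hM : ∀ y, Filter.Tendsto (fun k => M k y) Filter.atTop (𝓝 (N y)))
    (hb : Filter.Tendsto b Filter.atTop (𝓝 a)) {Φ : W × W → ℝ} (hΦ : Continuous Φ)
    {B : Set (ℝ ∙ e)ᗮ} (hB : volume B < ∞) :
    Filter.Tendsto (fun k => ∫ u in B, (gaugeChartDeriv (M k) e u).toLinearMap.normDet *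
        Φ (gaugeChart (M k) (b k) e u, ‖gradient (M k) (e + u)‖⁻¹ • gradient (M k) (e + u)))
      Filter.atTop
      (𝓝 (∫ u in B, (gaugeChartDeriv N e u).toLinearMap.normDet *
        Φ (gaugeChart N a e u, ‖gradient N (e + u)‖⁻¹ • gradient N (e + u)))) := by
  obtain ⟨A, hA⟩ := hb.norm.bddAbove_range
  have hA' : ∀ k, ‖b k‖ ≤ A := fun k => hA (mem_range_self k)
  have hK : IsCompact (Metric.closedBall (0 : W) (A + R) ×ˢ Metric.closedBall (0 : W) 1) :=
    (isCompact_closedBall _ _).prod (isCompact_closedBall _ _)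
  obtain ⟨C, hC⟩ := hK.exists_bound_of_continuousOn hΦ.continuousOn
  -- Chart derivatives stay in a closed ball of a finite-dimensional space, on which the continuous
  -- function `normDet` is bounded.
  have : FiniteDimensional ℝ ((ℝ ∙ e)ᗮ →L[ℝ] W) :=
    (LinearMap.toContinuousLinearMap (𝕜 := ℝ) (E := (ℝ ∙ e)ᗮ) (F' := W)).finiteDimensional
  have : ProperSpace ((ℝ ∙ e)ᗮ →L[ℝ] W) := FiniteDimensional.proper ℝ ((ℝ ∙ e)ᗮ →L[ℝ] W)
  have hK' : IsCompact (Metric.closedBall (0 : (ℝ ∙ e)ᗮ →L[ℝ] W) (R + R * R / r)) :=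
    isCompact_closedBall _ _
  obtain ⟨C', hC'⟩ := hK'.exists_bound_of_continuousOn
    (continuous_normDet (U := (ℝ ∙ e)ᗮ) (V := W)).continuousOn
  have hall : ∀ᵐ u : (ℝ ∙ e)ᗮ, (∀ k, DifferentiableAt ℝ (M k) (e + u)) ∧
      DifferentiableAt ℝ N (e + u) :=
    (ae_all_iff.2 fun k => (h k).ae_differentiableAt he).and (hN.ae_differentiableAt he)
  refine tendsto_integral_of_dominated_convergence (fun _ => C' * C) (fun k => ?_) ?_
    (fun k => ?_) ?_
  · refine Measurable.aestronglyMeasurable (Measurable.mul ?_ ?_)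
    · exact continuous_normDet.measurable.comp (h k).measurable_gaugeChartDeriv
    · refine hΦ.measurable.comp (Measurable.prodMk ?_ ?_)
      · exact ((h k).lipschitzWith_gaugeChart he).continuous.measurable
      · exact (measurable_normalizedGradient (M k)).comp
          (show Measurable fun u : (ℝ ∙ e)ᗮ => e + (u : W) by fun_prop)
  · have : IsFiniteMeasure (volume.restrict (B)) :=
      ⟨by simpa using hB⟩
    exact integrable_const _
  · refine ae_restrict_of_ae ?_
    filter_upwards [hall] with u hu
    rw [norm_mul]
    refine mul_le_mul (hC' _ ?_) (hC _ ⟨?_, ?_⟩) (norm_nonneg _) ((norm_nonneg _).trans (hC' 0 ?_))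
    · exact (dist_zero_right (gaugeChartDeriv (M k) e u)).trans_le
        ((h k).norm_gaugeChartDeriv_le he (hu.1 k))
    · rw [mem_closedBall_zero_iff]
      have h1 := (h k).lower (gaugeChart (M k) (b k) e u - b k)
      rw [(h k).apply_gaugeChart he u, mul_one] at h1
      have h2 := norm_add_le (b k) (gaugeChart (M k) (b k) e u - b k)
      rw [add_sub_cancel] at h2
      exact h2.trans (add_le_add (hA' k) h1)
    · rw [mem_closedBall_zero_iff]
      exact norm_normalizedGradient_le _ _
    · exact Metric.mem_closedBall_self (by have := hN.r_pos; have := hN.R_pos; positivity)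
  · refine ae_restrict_of_ae ?_
    filter_upwards [hall] with u hu
    have hpos := hN.pos (add_orthogonal_ne_zero he u)
    have h1 := (hM (e + u)).inv₀ hpos.ne'
    have h2 : Filter.Tendsto (fun k => fderiv ℝ (M k) (e + u)) Filter.atTop
        (𝓝 (fderiv ℝ N (e + u))) :=
      tendsto_fderiv h hM (fun k => (hu.1 k).hasFDerivAt) hu.2.hasFDerivAt
    have h3 : Filter.Tendsto (fun k => gradient (M k) (e + u)) Filter.atTop
        (𝓝 (gradient N (e + u))) :=
      ((InnerProductSpace.toDual ℝ W).symm.continuous.tendsto _).comp h2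
    have h4 : Filter.Tendsto (fun k => gaugeChartDeriv (M k) e u) Filter.atTop
        (𝓝 (gaugeChartDeriv N e u)) := by
      have hc : Continuous fun T : W →L[ℝ] ℝ =>
          (T.comp (ℝ ∙ e)ᗮ.subtypeL).smulRight (e + (u : W)) :=
        ((ContinuousLinearMap.smulRightL ℝ (ℝ ∙ e)ᗮ W).continuous₂.comp
          ((show Continuous fun T : W →L[ℝ] ℝ => T.comp (ℝ ∙ e)ᗮ.subtypeL by fun_prop).prodMk
            continuous_const))
      exact (h1.smul_const _).sub ((((hM (e + u)).pow 2).inv₀ (pow_pos hpos 2).ne').smul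
        ((hc.tendsto _).comp h2))
    refine ((continuous_normDet.tendsto _).comp h4).mul ((hΦ.tendsto _).comp ?_)
    refine Filter.Tendsto.prodMk_nhds ?_ ?_
    · exact hb.add (h1.smul_const _)
    · exact (h3.norm.inv₀ (hN.norm_gradient_pos hpos hu.2).ne').smul h3

theorem tendsto_setIntegral_frontier (hd : finrank ℝ W = d + 1) (h : ∀ k, IsGauge r R (M k))
    (hN : IsGauge r R N)
    (hM : ∀ y, Filter.Tendsto (fun k => M k y) Filter.atTop (𝓝 (N y)))
    (hb : Filter.Tendsto b Filter.atTop (𝓝 a)) {Φ : W × W → ℝ} (hΦ : Continuous Φ) :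
    Filter.Tendsto (fun k => ∫ x in frontier (gaugeBody (M k) (b k)),
        Φ (x, ‖gradient (M k) (x - b k)‖⁻¹ • gradient (M k) (x - b k)) ∂μHE[d]) Filter.atTop
      (𝓝 (∫ x in frontier (gaugeBody N a),
        Φ (x, ‖gradient N (x - a)‖⁻¹ • gradient N (x - a)) ∂μHE[d])) := by
  obtain ⟨P⟩ := nonempty_conePartition (W := W)
  simp only [fun k => (h k).setIntegral_frontier (a := b k) hd P hΦ,
    hN.setIntegral_frontier (a := a) hd P hΦ]
  refine tendsto_finsetSum _ fun j _ => ?_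
  exact tendsto_setIntegral_gaugeChart (P.norm_axis j) h hN hM hb hΦ (P.volume_base_lt_top j)

/-- The default value of `outerNormal` at singular boundary points is immaterial, since the gauge is
differentiable at almost every boundary point. -/
theorem setIntegral_outerNormal {n d : ℕ} {N : AnisotropicMomentum.E n → ℝ}
    {a : AnisotropicMomentum.E n} (h : IsGauge r R N) (hd : n = d + 1)
    (Φ : AnisotropicMomentum.E n × AnisotropicMomentum.E n → ℝ) :
    ∫ x in frontier (gaugeBody N a),
        Φ (x, AnisotropicMomentum.outerNormal (gaugeBody N a) x) ∂μHE[d] =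
      ∫ x in frontier (gaugeBody N a),
        Φ (x, ‖gradient N (x - a)‖⁻¹ • gradient N (x - a)) ∂μHE[d] := by
  refine integral_congr_ae ?_
  filter_upwards [h.ae_frontier_differentiableAt (a := a) (d := d) (by simpa using hd)] with x hx
  rw [h.outerNormal_eq hx.1 hx.2]

end IsGauge

/-! ### The boundary of a convex set does not concentrate near the origin. -/

section NonConcentration

variable {W : Type*} [NormedAddCommGroup W] [InnerProductSpace ℝ W] [FiniteDimensional ℝ W]

theorem OrthonormalBasis.exists_norm_le_mul_abs_inner {d : ℕ} (hd : finrank ℝ W = d + 1)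
    (b : OrthonormalBasis (Fin (finrank ℝ W)) ℝ W) (v : W) :
    ∃ i, ‖v‖ ≤ (d + 1) * |inner ℝ (b i) v| := by
  by_contra! h
  have hne : (Finset.univ : Finset (Fin (finrank ℝ W))).Nonempty :=
    ⟨⟨0, by omega⟩, Finset.mem_univ _⟩
  have h2 : (d + 1 : ℝ) * ‖v‖ < (d + 1) * ‖v‖ := by
    calc (d + 1 : ℝ) * ‖v‖ = (d + 1) * ‖∑ i, inner ℝ (b i) v • b i‖ := by rw [b.sum_repr' v]
      _ ≤ (d + 1) * ∑ i, ‖inner ℝ (b i) v • b i‖ := by gcongr; exact norm_sum_le _ _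
      _ = ∑ i, (d + 1 : ℝ) * |inner ℝ (b i) v| := by
        rw [Finset.mul_sum]
        simp [norm_smul, b.norm_eq_one]
      _ < ∑ _i : Fin (finrank ℝ W), ‖v‖ := Finset.sum_lt_sum_of_nonempty hne fun i _ => h i
      _ = (d + 1) * ‖v‖ := by simp [hd]
  exact lt_irrefl _ h2

/-- There is an orthonormal basis all of whose vectors are far from the direction of `q`. -/
theorem exists_orthonormalBasis_inner_sq_le (h2 : 2 ≤ finrank ℝ W) (q : W) :
    ∃ b : OrthonormalBasis (Fin (finrank ℝ W)) ℝ W, ∀ i, 2 * inner ℝ (b i) q ^ 2 ≤ ‖q‖ ^ 2 := by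
  let b := stdOrthonormalBasis ℝ W
  let i₀ : Fin (finrank ℝ W) := ⟨0, by omega⟩
  let i₁ : Fin (finrank ℝ W) := ⟨1, by omega⟩
  have h01 : i₀ ≠ i₁ := by simp [i₀, i₁, Fin.ext_iff]
  -- A reflection carries `w`, which lies along `b i₀ + b i₁`, to `q`. In the reflected basis `q`
  -- has at most two nonzero coordinates, each of modulus `‖q‖ / √2`.
  set w : W := (‖q‖ / √2) • (b i₀ + b i₁) with hw
  have hs : ‖b i₀ + b i₁‖ = √2 := by
    have h := norm_add_sq_eq_norm_sq_add_norm_sq_real (b.orthonormal.2 h01)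
    rw [b.norm_eq_one, b.norm_eq_one] at h
    rw [← Real.sqrt_sq (norm_nonneg (b i₀ + b i₁)), sq, h]
    norm_num
  have hwq : ‖w‖ = ‖q‖ := by
    rw [hw, norm_smul, hs, Real.norm_of_nonneg (by positivity), div_mul_cancel₀ _ (by positivity)]
  set T := (ℝ ∙ (w - q))ᗮ.reflection with hT
  have hTw : T w = q := Submodule.reflection_sub hwq
  refine ⟨b.map T, fun i => ?_⟩
  rw [b.map_apply, ← hTw, T.inner_map_map, T.norm_map, hwq, hw, inner_smul_right, inner_add_right]
  have horth := orthonormal_iff_ite.1 b.orthonormal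
  rw [horth, horth, mul_pow, div_pow, Real.sq_sqrt zero_le_two]
  have h3 : ((if i = i₀ then (1 : ℝ) else 0) + if i = i₁ then (1 : ℝ) else 0) ^ 2 ≤ 1 := by
    split_ifs with h4 h5
    · exact absurd (h4.symm.trans h5) h01
    all_goals norm_num
  nlinarith [sq_nonneg ‖q‖]

theorem norm_sq_orthogonalProjectionOnto {e : W} (he : ‖e‖ = 1) (x : W) :
    ‖(ℝ ∙ e)ᗮ.orthogonalProjectionOnto x‖ ^ 2 = ‖x‖ ^ 2 - inner ℝ e x ^ 2 := by
  have h := (ℝ ∙ e).norm_sq_eq_add_norm_sq_starProjection x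
  rw [Submodule.starProjection_unit_singleton ℝ he, norm_smul, he, mul_one, Real.norm_eq_abs,
    sq_abs] at h
  have h2 : ‖(ℝ ∙ e)ᗮ.orthogonalProjectionOnto x‖ = ‖(ℝ ∙ e)ᗮ.starProjection x‖ := rfl
  rw [h2]
  linarith

theorem eq_inner_smul_add_orthogonalProjectionOnto {e : W} (he : ‖e‖ = 1) (x : W) :
    x = inner ℝ e x • e + ((ℝ ∙ e)ᗮ.orthogonalProjectionOnto x : W) := by
  have h3 := (ℝ ∙ e).starProjection_add_starProjection_orthogonal x
  rw [Submodule.starProjection_unit_singleton ℝ he] at h3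
  exact h3.symm

theorem exists_mem_frontier_of_mem {Ω : Set W} (hb : Bornology.IsBounded Ω) {z e : W}
    (hz : z ∈ Ω) (he : ‖e‖ = 1) : ∃ t : ℝ, z + t • e ∈ frontier Ω := by
  have hcont : Continuous fun t : ℝ => z + t • e := by fun_prop
  obtain ⟨C, hC⟩ := hb.exists_norm_le
  have hfr : (frontier ((fun t : ℝ => z + t • e) ⁻¹' Ω)).Nonempty := by
    refine nonempty_frontier_iff.2 ⟨⟨0, by simpa using hz⟩, fun huniv => ?_⟩
    have hmem : z + (‖z‖ + |C| + 1) • e ∈ Ω := by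
      have : ‖z‖ + |C| + 1 ∈ (fun t : ℝ => z + t • e) ⁻¹' Ω := huniv ▸ mem_univ _
      exact this
    have h3 := hC _ hmem
    have h4 := norm_sub_le (z + (‖z‖ + |C| + 1) • e) z
    rw [add_sub_cancel_left, norm_smul, he, mul_one, Real.norm_of_nonneg (by positivity)] at h4
    have := le_abs_self C
    linarith
  obtain ⟨t, ht⟩ := hfr
  exact ⟨t, hcont.frontier_preimage_subset Ω ht⟩

theorem exists_supporting_unit_vector {Ω : Set W} (ho : IsOpen Ω) (hc : Convex ℝ Ω) {x : W}
    (hx : x ∉ Ω) (hne : Ω.Nonempty) : ∃ ν : W, ‖ν‖ = 1 ∧ ∀ y ∈ Ω, inner ℝ (y - x) ν < 0 := by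
  obtain ⟨f, hf⟩ := geometric_hahn_banach_open_point hc ho hx
  set w := (InnerProductSpace.toDual ℝ W).symm f with hw
  have hfw : ∀ y, f y = inner ℝ y w := fun y => by
    rw [hw, real_inner_comm, InnerProductSpace.toDual_symm_apply]
  have hw0 : w ≠ 0 := by
    intro h0
    obtain ⟨y, hy⟩ := hne
    have := hf y hy
    rw [hfw, hfw, h0, inner_zero_right, inner_zero_right] at this
    exact lt_irrefl _ this
  refine ⟨‖w‖⁻¹ • w, ?_, fun y hy => ?_⟩
  · rw [norm_smul, norm_inv, norm_norm, inv_mul_cancel₀ (norm_ne_zero_iff.2 hw0)]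
  · rw [inner_smul_right, inner_sub_left, ← hfw, ← hfw]
    have := hf y hy
    exact mul_neg_of_pos_of_neg (inv_pos.2 (norm_pos_iff.2 hw0)) (by linarith)

variable [MeasurableSpace W] [BorelSpace W]

theorem euclideanHausdorffMeasure_le_image_of_dist_le {X Y : Type*} [MetricSpace X]
    [MeasurableSpace X] [BorelSpace X] [MetricSpace Y] [MeasurableSpace Y] [BorelSpace Y]
    {K : ℝ≥0} {f : X → Y} {s : Set X} (h : ∀ x ∈ s, ∀ y ∈ s, dist x y ≤ K * dist (f x) (f y))
    (d : ℕ) : μHE[d] s ≤ (K : ℝ≥0∞) ^ d * μHE[d] (f '' s) := by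
  rcases s.eq_empty_or_nonempty with rfl | ⟨z, -⟩
  · simp
  have : Nonempty X := ⟨z⟩
  have hinj : InjOn f s := by
    intro x hx y hy hxy
    have := h x hx y hy
    rw [hxy, dist_self, mul_zero] at this
    exact dist_le_zero.1 this
  have hl : LipschitzOnWith K (Function.invFunOn f s) (f '' s) := by
    refine LipschitzOnWith.of_dist_le_mul ?_
    rintro _ ⟨x, hx, rfl⟩ _ ⟨y, hy, rfl⟩
    rw [hinj.leftInvOn_invFunOn hx, hinj.leftInvOn_invFunOn hy]
    exact h x hx y hy
  have := hl.euclideanHausdorffMeasure_image_le d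
  rwa [hinj.leftInvOn_invFunOn.image_image] at this

/-- A subset of the boundary of an open convex set whose outer normals are all inclined by a fixed
amount against `e` is bi-Lipschitz equivalent to its projection along `e`. -/
theorem dist_le_of_inclined_normals {Ω : Set W} {e : W} (he : ‖e‖ = 1) {K : ℝ} (hK : 0 < K)
    {x y ν ν' : W} (hν : ‖ν‖ = 1) (hν' : ‖ν'‖ = 1) (hx : x ∈ closure Ω) (hy : y ∈ closure Ω)
    (hxν : ∀ z ∈ Ω, inner ℝ (z - x) ν ≤ 0) (hyν : ∀ z ∈ Ω, inner ℝ (z - y) ν' ≤ 0)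
    (h1 : 1 ≤ K * inner ℝ e ν) (h2 : 1 ≤ K * inner ℝ e ν') :
    ‖x - y‖ ≤ (1 + K) * ‖(ℝ ∙ e)ᗮ.orthogonalProjectionOnto (x - y)‖ := by
  have hcl : ∀ (v w : W), (∀ z ∈ Ω, inner ℝ (z - v) w ≤ 0) →
      ∀ z ∈ closure Ω, inner ℝ (z - v) w ≤ 0 := by
    intro v w h z hz
    have hcont : Continuous fun z : W => inner ℝ (z - v) w := by fun_prop
    exact closure_minimal (t := {z | inner ℝ (z - v) w ≤ 0}) h
      (isClosed_le hcont continuous_const) hz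
  have e1 := hcl y ν' hyν x hx
  have e2 := hcl x ν hxν y hy
  set p : W := ((ℝ ∙ e)ᗮ.orthogonalProjectionOnto (x - y) : W) with hp
  set t := inner ℝ e (x - y) with ht
  have hdec : x - y = t • e + p := eq_inner_smul_add_orthogonalProjectionOnto he (x - y)
  have hpn : ‖(ℝ ∙ e)ᗮ.orthogonalProjectionOnto (x - y)‖ = ‖p‖ := rfl
  rw [← neg_sub, hdec, inner_neg_left, inner_add_left, inner_smul_left, conj_trivial] at e2
  rw [hdec, inner_add_left, inner_smul_left, conj_trivial] at e1
  have e3 : -‖p‖ ≤ inner ℝ p ν' := by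
    have := (abs_le.1 (abs_real_inner_le_norm p ν')).1
    rwa [hν', mul_one] at this
  have e4 : inner ℝ p ν ≤ ‖p‖ := by
    have := real_inner_le_norm p ν
    rwa [hν, mul_one] at this
  -- The supporting half-space at the lower of the two points bounds how far the other one can rise
  -- in direction `e`: if `t ≥ 0`, then `t * ⟨e, ν'⟩ ≤ ‖p‖`.
  have ht' : |t| ≤ K * ‖p‖ := by
    rcases le_total 0 t with h | h
    · rw [abs_of_nonneg h]
      nlinarith [mul_le_mul_of_nonneg_left h2 h]
    · rw [abs_of_nonpos h]
      nlinarith [mul_le_mul_of_nonneg_left h1 (neg_nonneg.2 h)]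
  rw [hpn, hdec]
  refine (norm_add_le _ _).trans ?_
  rw [norm_smul, he, mul_one, Real.norm_eq_abs]
  linarith

/-- Each outer unit normal has a coordinate of modulus at least `1 / (d + 1)`. Sorting points by the
index and sign of this coordinate gives pieces on which the projection along `b i` has a `(d +
2)`-Lipschitz inverse. -/
theorem euclideanHausdorffMeasure_le_sum_projections {d : ℕ} (hd : finrank ℝ W = d + 1)
    {Ω A : Set W} (ho : IsOpen Ω) (hc : Convex ℝ Ω) (hne : Ω.Nonempty) (hA : A ⊆ frontier Ω)
    (b : OrthonormalBasis (Fin (finrank ℝ W)) ℝ W) :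
    μHE[d] A ≤ ∑ i, 2 * ((d + 2 : ℝ≥0) : ℝ≥0∞) ^ d *
      μHE[d] ((ℝ ∙ b i)ᗮ.orthogonalProjectionOnto '' A) := by
  set S : Fin (finrank ℝ W) → ℝ → Set W := fun i σ => {x ∈ A | ∃ ν : W, ‖ν‖ = 1 ∧
    (∀ z ∈ Ω, inner ℝ (z - x) ν ≤ 0) ∧ 1 ≤ (d + 1 : ℝ) * (inner ℝ (σ • b i) ν)} with hS
  have hcover : A ⊆ ⋃ i, (S i 1 ∪ S i (-1)) := by
    intro x hx
    have hx' : x ∉ Ω := by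
      have := hA hx
      rw [ho.frontier_eq] at this
      exact this.2
    obtain ⟨ν, hν1, hν⟩ := exists_supporting_unit_vector ho hc hx' hne
    obtain ⟨i, hi⟩ := b.exists_norm_le_mul_abs_inner hd ν
    rw [hν1] at hi
    refine mem_iUnion.2 ⟨i, ?_⟩
    rcases le_total 0 (inner ℝ (b i) ν) with h | h
    · rw [abs_of_nonneg h] at hi
      exact Or.inl ⟨hx, ν, hν1, fun z hz => (hν z hz).le, by simpa using hi⟩
    · rw [abs_of_nonpos h] at hi
      exact Or.inr ⟨hx, ν, hν1, fun z hz => (hν z hz).le, by simpa using hi⟩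
  have hpiece : ∀ i, ∀ σ : ℝ, |σ| = 1 → μHE[d] (S i σ) ≤ ((d + 2 : ℝ≥0) : ℝ≥0∞) ^ d *
      μHE[d] ((ℝ ∙ b i)ᗮ.orthogonalProjectionOnto '' A) := by
    intro i σ hσ
    have hσe : ‖σ • b i‖ = 1 := by rw [norm_smul, b.norm_eq_one, mul_one, Real.norm_eq_abs, hσ]
    have hproj : ∀ v, ‖(ℝ ∙ (σ • b i))ᗮ.orthogonalProjectionOnto v‖ =
        ‖(ℝ ∙ b i)ᗮ.orthogonalProjectionOnto v‖ := by
      intro v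
      rw [← sq_eq_sq₀ (norm_nonneg _) (norm_nonneg _), norm_sq_orthogonalProjectionOnto hσe,
        norm_sq_orthogonalProjectionOnto (b.norm_eq_one i), inner_smul_left, conj_trivial, mul_pow,
        ← sq_abs σ, hσ, one_pow, one_mul]
    refine (euclideanHausdorffMeasure_le_image_of_dist_le
      (f := (ℝ ∙ b i)ᗮ.orthogonalProjectionOnto) (K := d + 2) ?_ d).trans ?_
    · rintro x ⟨hx, ν, hν1, hν, hi⟩ y ⟨hy, ν', hν1', hν', hi'⟩
      have := dist_le_of_inclined_normals hσe (K := d + 1) (by positivity) hν1 hν1'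
        (frontier_subset_closure (hA hx)) (frontier_subset_closure (hA hy)) hν hν' hi hi'
      rw [dist_eq_norm, dist_eq_norm, ← map_sub]
      rw [hproj] at this
      push_cast
      linarith
    · gcongr
      exact fun x hx => hx.1
  calc μHE[d] A ≤ μHE[d] (⋃ i, (S i 1 ∪ S i (-1))) := measure_mono hcover
    _ ≤ ∑' i, μHE[d] (S i 1 ∪ S i (-1)) := measure_iUnion_le _
    _ = ∑ i, μHE[d] (S i 1 ∪ S i (-1)) := tsum_fintype _
    _ ≤ _ := by
      refine Finset.sum_le_sum fun i _ => (measure_union_le _ _).trans ?_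
      rw [mul_assoc, two_mul]
      exact add_le_add (hpiece i 1 (by simp)) (hpiece i (-1) (by simp))

/-- For a boundary point `x` near 0, the line in direction `e` through the midpoint of `x` and `q`
meets the boundary at some `y` with `P x = 2 • P y - P q`. As `e` is far from the direction of `q`,
`P q` is long and `y` lies outside the ball. So a 2-Lipschitz image of the far part covers the
projected near part. -/
theorem measure_projection_inter_ball_le {d : ℕ} {Ω : Set W} (ho : IsOpen Ω) (hc : Convex ℝ Ω)
    (hb : Bornology.IsBounded Ω) {q e : W} (hq : q ∈ Ω) (he : ‖e‖ = 1)
    (heq : 2 * inner ℝ e q ^ 2 ≤ ‖q‖ ^ 2) :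
    μHE[d] ((ℝ ∙ e)ᗮ.orthogonalProjectionOnto '' (frontier Ω ∩ Metric.ball 0 (‖q‖ / 8))) ≤
      2 ^ d * μHE[d] (frontier Ω \ Metric.ball 0 (‖q‖ / 8)) := by
  set P := (ℝ ∙ e)ᗮ.orthogonalProjectionOnto with hP
  have hPn : ∀ x, ‖P x‖ ≤ ‖x‖ := fun x => (ℝ ∙ e)ᗮ.norm_orthogonalProjectionOnto_apply_le x
  have hPe : P e = 0 := by simp [hP]
  have hsub : P '' (frontier Ω ∩ Metric.ball 0 (‖q‖ / 8)) ⊆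
      (fun x => (2 : ℝ) • P x - P q) '' (frontier Ω \ Metric.ball 0 (‖q‖ / 8)) := by
    rintro _ ⟨x, ⟨hx, hxb⟩, rfl⟩
    have hz : (2⁻¹ : ℝ) • x + (2⁻¹ : ℝ) • q ∈ Ω := by
      have := hc.combo_closure_interior_mem_interior (frontier_subset_closure hx)
        (by rwa [ho.interior_eq]) (a := 2⁻¹) (b := 2⁻¹) (by norm_num) (by norm_num) (by norm_num)
      rwa [ho.interior_eq] at this
    obtain ⟨t, ht⟩ := exists_mem_frontier_of_mem hb hz he
    have hPy : P ((2⁻¹ : ℝ) • x + (2⁻¹ : ℝ) • q + t • e) = (2⁻¹ : ℝ) • (P x + P q) := by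
      rw [map_add, map_add, map_smul, map_smul, map_smul, hPe, smul_zero, add_zero, smul_add]
    refine ⟨_, ⟨ht, fun hball => ?_⟩, ?_⟩
    · rw [mem_ball_zero_iff] at hball hxb
      have h1 := hPn ((2⁻¹ : ℝ) • x + (2⁻¹ : ℝ) • q + t • e)
      rw [hPy, norm_smul, Real.norm_of_nonneg (by norm_num)] at h1
      have h2 : ‖P q‖ - ‖P x‖ ≤ ‖P x + P q‖ := by
        have := norm_sub_le (P x + P q) (P x)
        rw [add_sub_cancel_left] at this
        linarith
      have h3 := norm_sq_orthogonalProjectionOnto he q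
      have h4 := hPn x
      -- If `y` were in the ball, `‖P q‖ < (2/8 + 1/8) * ‖q‖`, against `‖P q‖ ^ 2 ≥ ‖q‖ ^ 2 / 2`.
      have h5 : ‖P q‖ < 3 / 8 * ‖q‖ := by linarith
      have h6 : ‖P q‖ ^ 2 = ‖q‖ ^ 2 - inner ℝ e q ^ 2 := h3
      nlinarith [norm_nonneg (P q), norm_nonneg q]
    · simp only [hPy]
      rw [smul_smul]
      norm_num
  have hl : LipschitzWith 2 fun x => (2 : ℝ) • P x - P q := by
    refine LipschitzWith.of_dist_le_mul fun x y => ?_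
    rw [dist_sub_right, dist_smul₀, dist_eq_norm, dist_eq_norm, ← map_sub]
    simpa using hPn (x - y)
  refine (measure_mono hsub).trans ?_
  simpa using (hl.lipschitzOnWith
    (s := frontier Ω \ Metric.ball 0 (‖q‖ / 8))).euclideanHausdorffMeasure_image_le d

/-- The boundary of a convex set reaching far from the origin does not concentrate near the
origin. -/
theorem measure_frontier_le_mul_measure_diff_ball {d : ℕ} (hd : finrank ℝ W = d + 1)
    (hd1 : 1 ≤ d) : ∃ C : ℝ≥0, ∀ Ω : Set W, IsOpen Ω → Convex ℝ Ω → Bornology.IsBounded Ω →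
      ∀ q ∈ Ω, μHE[d] (frontier Ω) ≤ C * μHE[d] (frontier Ω \ Metric.ball 0 (‖q‖ / 8)) := by
  -- There are `d + 1` directions, each contributing `2 * (d + 2) ^ d` from the projection estimate
  -- times `2 ^ d` from the midpoint map; the final 1 accounts for the far part itself.
  refine ⟨(d + 1) * (2 * (d + 2) ^ d * 2 ^ d) + 1, fun Ω ho hc hb q hq => ?_⟩
  obtain ⟨b, hbq⟩ := exists_orthonormalBasis_inner_sq_le (by omega) q
  have h1 := euclideanHausdorffMeasure_le_sum_projections hd ho hc ⟨q, hq⟩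
    (inter_subset_left (s := frontier Ω) (t := Metric.ball 0 (‖q‖ / 8))) b
  have h2 : ∀ i ∈ Finset.univ, 2 * ((d + 2 : ℝ≥0) : ℝ≥0∞) ^ d *
      μHE[d] ((ℝ ∙ b i)ᗮ.orthogonalProjectionOnto '' (frontier Ω ∩ Metric.ball 0 (‖q‖ / 8))) ≤
      2 * ((d + 2 : ℝ≥0) : ℝ≥0∞) ^ d *
        (2 ^ d * μHE[d] (frontier Ω \ Metric.ball 0 (‖q‖ / 8))) := fun i _ => by
    gcongr
    exact measure_projection_inter_ball_le ho hc hb hq (b.norm_eq_one i) (hbq i)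
  have h3 := h1.trans (Finset.sum_le_sum h2)
  rw [Finset.sum_const, Finset.card_univ, Fintype.card_fin, hd, nsmul_eq_mul] at h3
  rw [← measure_inter_add_sdiff (frontier Ω) (measurableSet_ball (x := (0 : W)) (ε := ‖q‖ / 8))]
  refine (add_le_add h3 le_rfl).trans (le_of_eq ?_)
  push_cast
  ring

/-- Lines through points of a bounded set meet its boundary, so the projection of the boundary
covers the nonempty open projection of `Ω`. -/
theorem measure_frontier_pos {d : ℕ} (hd : finrank ℝ W = d + 1) {Ω : Set W} (ho : IsOpen Ω)
    (hb : Bornology.IsBounded Ω) (hne : Ω.Nonempty) : 0 < μHE[d] (frontier Ω) := by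
  let e := stdOrthonormalBasis ℝ W ⟨0, by omega⟩
  have he : ‖e‖ = 1 := (stdOrthonormalBasis ℝ W).norm_eq_one _
  set P := (ℝ ∙ e)ᗮ.orthogonalProjectionOnto with hP
  have hPe : P e = 0 := by simp [hP]
  have hsub : P '' Ω ⊆ P '' frontier Ω := by
    rintro _ ⟨x, hx, rfl⟩
    obtain ⟨t, ht⟩ := exists_mem_frontier_of_mem hb hx he
    exact ⟨_, ht, by rw [map_add, map_smul, hPe, smul_zero, add_zero]⟩
  have hopen : IsOpen (P '' Ω) := by
    refine P.isOpenMap ?_ Ω ho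
    intro u
    exact ⟨u, Submodule.orthogonalProjectionOnto_mem_subspace_eq_self u⟩
  have h1 : 0 < volume (P '' Ω) := hopen.measure_pos volume (hne.image P)
  have h2 := ((ℝ ∙ e)ᗮ.lipschitzWith_orthogonalProjectionOnto.lipschitzOnWith
    (s := frontier Ω)).euclideanHausdorffMeasure_image_le (finrank ℝ (ℝ ∙ e)ᗮ)
  rw [InnerProductSpace.euclideanHausdorffMeasure_eq_volume,
    IsGauge.finrank_orthogonal_axis hd he, ENNReal.coe_one, one_pow, one_mul] at h2
  exact h1.trans_le ((measure_mono hsub).trans h2)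

end NonConcentration

/-! ### Bounds and continuity for a Finsler norm and its polar. -/

namespace AnisotropicMomentum

namespace IsFinslerNorm

variable {n : ℕ} {p : ℝ} {F : E n → ℝ}

theorem continuous (hF : IsFinslerNorm n p F) : Continuous F :=
  continuousOn_univ.1 (hF.convex.continuousOn isOpen_univ)

theorem exists_le_mul_norm (hF : IsFinslerNorm n p F) : ∃ b : ℝ, 0 < b ∧ ∀ ξ, F ξ ≤ b * ‖ξ‖ := by
  obtain ⟨C, hC⟩ := (isCompact_closedBall (0 : E n) 1).exists_bound_of_continuousOn
    hF.continuous.continuousOn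
  refine ⟨|C| + 1, by positivity, fun ξ => ?_⟩
  rcases eq_or_ne ξ 0 with rfl | hξ
  · have := hF.homogeneous 0 0
    simp only [zero_smul, abs_zero, zero_mul] at this
    simp [this]
  · have h1 : F ξ = ‖ξ‖ * F (‖ξ‖⁻¹ • ξ) := by
      rw [hF.homogeneous, abs_of_nonneg (by positivity), mul_inv_cancel_left₀ (norm_ne_zero_iff.2 hξ)]
    have h2 : F (‖ξ‖⁻¹ • ξ) ≤ |C| + 1 := by
      have := hC (‖ξ‖⁻¹ • ξ) (by
        rw [mem_closedBall_zero_iff, norm_smul, norm_inv, norm_norm,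
          inv_mul_cancel₀ (norm_ne_zero_iff.2 hξ)])
      have h3 := le_abs_self (F (‖ξ‖⁻¹ • ξ))
      rw [Real.norm_eq_abs] at this
      linarith [le_abs_self C]
    rw [h1, mul_comm]
    gcongr

theorem pos (hF : IsFinslerNorm n p F) {ξ : E n} (hξ : ξ ≠ 0) : 0 < F ξ := by
  obtain ⟨a, ha, h⟩ := hF.lower_bound
  exact (mul_pos ha (norm_pos_iff.2 hξ)).trans_le (h ξ)

theorem inner_div_le {a : ℝ} (ha : 0 < a) (h : ∀ ξ : E n, a * ‖ξ‖ ≤ F ξ) (v : E n)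
    (ξ : {ξ : E n // ξ ≠ 0}) : inner ℝ (ξ : E n) v / F ξ ≤ ‖v‖ / a := by
  have h1 : 0 < ‖(ξ : E n)‖ := norm_pos_iff.2 ξ.2
  have h2 := h ξ
  have h3 : 0 < F ξ := (mul_pos ha h1).trans_le h2
  rw [div_le_div_iff₀ h3 ha]
  calc inner ℝ (ξ : E n) v * a ≤ ‖(ξ : E n)‖ * ‖v‖ * a := by
        gcongr
        exact real_inner_le_norm _ _
    _ = ‖v‖ * (a * ‖(ξ : E n)‖) := by ring
    _ ≤ ‖v‖ * F ξ := by gcongr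

theorem bddAbove_polar (hF : IsFinslerNorm n p F) (v : E n) :
    BddAbove (range fun ξ : {ξ : E n // ξ ≠ 0} => inner ℝ (ξ : E n) v / F ξ) := by
  obtain ⟨a, ha, h⟩ := hF.lower_bound
  refine ⟨‖v‖ / a, ?_⟩
  rintro _ ⟨ξ, rfl⟩
  exact inner_div_le ha h v ξ

theorem nonempty_ne_zero (hn : 2 ≤ n) : Nonempty {ξ : E n // ξ ≠ 0} := by
  refine ⟨⟨EuclideanSpace.single ⟨0, by omega⟩ 1, ?_⟩⟩
  rw [ne_eq, ← norm_eq_zero]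
  simp

theorem polar_le_add (hF : IsFinslerNorm n p F) (hn : 2 ≤ n) {a : ℝ} (ha : 0 < a)
    (h : ∀ ξ, a * ‖ξ‖ ≤ F ξ) (v w : E n) : polar F v ≤ polar F w + a⁻¹ * ‖v - w‖ := by
  have := nonempty_ne_zero hn
  refine ciSup_le fun ξ => ?_
  have h1 := inner_div_le ha h (v - w) ξ
  have h2 := le_ciSup (hF.bddAbove_polar w) ξ
  have h3 : inner ℝ (ξ : E n) v / F ξ =
      inner ℝ (ξ : E n) w / F ξ + inner ℝ (ξ : E n) (v - w) / F ξ := by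
    rw [inner_sub_right]
    ring
  rw [h3, ← div_eq_inv_mul]
  exact add_le_add h2 h1

theorem continuous_polar (hF : IsFinslerNorm n p F) (hn : 2 ≤ n) : Continuous (polar F) := by
  obtain ⟨a, ha, h⟩ := hF.lower_bound
  refine (LipschitzWith.of_le_add_mul (a⁻¹).toNNReal fun v w => ?_).continuous
  rw [Real.coe_toNNReal _ (by positivity), dist_eq_norm]
  exact hF.polar_le_add hn ha h v w

theorem le_polar (hF : IsFinslerNorm n p F) (hn : 2 ≤ n) {b : ℝ} (hb : 0 < b)
    (h : ∀ ξ, F ξ ≤ b * ‖ξ‖) (v : E n) : ‖v‖ / b ≤ polar F v := by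
  rcases eq_or_ne v 0 with rfl | hv
  · have := nonempty_ne_zero hn
    simp [polar]
  · refine le_trans ?_ (le_ciSup (hF.bddAbove_polar v) ⟨v, hv⟩)
    have h1 : 0 < ‖v‖ := norm_pos_iff.2 hv
    rw [real_inner_self_eq_norm_sq, div_le_div_iff₀ hb (hF.pos hv)]
    nlinarith [h v]

theorem polar_nonneg (hF : IsFinslerNorm n p F) (hn : 2 ≤ n) (v : E n) : 0 ≤ polar F v := by
  obtain ⟨b, hb, h⟩ := hF.exists_le_mul_norm
  exact le_trans (by positivity) (hF.le_polar hn hb h v)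

theorem continuous_momentum_integrand (hF : IsFinslerNorm n p F) (hn : 2 ≤ n) (hp : 0 ≤ p) :
    Continuous fun z : E n × E n => polar F z.1 ^ p * F z.2 :=
  (((hF.continuous_polar hn).comp continuous_fst).rpow_const fun _ => Or.inr hp).mul
    (hF.continuous.comp continuous_snd)

end IsFinslerNorm

/-! ### Behaviour under dilations. -/

theorem polar_smul {n : ℕ} (F : E n → ℝ) {t : ℝ} (ht : 0 ≤ t) (v : E n) :
    polar F (t • v) = t * polar F v := by
  rw [polar, polar, Real.mul_iSup_of_nonneg ht]
  congr 1
  funext ξ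
  rw [inner_smul_right, mul_div_assoc]

section Scaling

variable {n : ℕ} {t : ℝ} {Ω : Set (E n)}

theorem isOuterUnitNormal_smul_iff (ht : 0 < t) (x ν : E n) :
    IsOuterUnitNormal (t • Ω) (t • x) ν ↔ IsOuterUnitNormal Ω x ν := by
  refine and_congr_right fun _ => ⟨fun h y hy => ?_, fun h z hz => ?_⟩
  · have h1 := h (t • y) (smul_mem_smul_set hy)
    rw [← smul_sub, inner_smul_left, conj_trivial] at h1
    exact nonpos_of_mul_nonpos_right h1 ht
  · obtain ⟨y, hy, rfl⟩ := hz
    rw [← smul_sub, inner_smul_left, conj_trivial]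
    exact mul_nonpos_of_nonneg_of_nonpos ht.le (h y hy)

theorem outerNormal_smul (ht : 0 < t) (x : E n) :
    outerNormal (t • Ω) (t • x) = outerNormal Ω x := by
  by_cases h : ∃! ν, IsOuterUnitNormal Ω x ν
  · have h' : ∃! ν, IsOuterUnitNormal (t • Ω) (t • x) ν := by
      simpa only [isOuterUnitNormal_smul_iff ht] using h
    rw [outerNormal, outerNormal, dif_pos h, dif_pos h']
    exact h.unique ((isOuterUnitNormal_smul_iff ht _ _).1 h'.choose_spec.1) h.choose_spec.1
  · have h' : ¬ ∃! ν, IsOuterUnitNormal (t • Ω) (t • x) ν := by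
      simpa only [isOuterUnitNormal_smul_iff ht] using h
    rw [outerNormal, outerNormal, dif_neg h, dif_neg h']

theorem setIntegral_smul_euclideanHausdorffMeasure (ht : 0 < t) (d : ℕ) (s : Set (E n))
    (g : E n → ℝ) :
    ∫ x in t • s, g x ∂μHE[d] = t ^ d * ∫ x in s, g (t • x) ∂μHE[d] := by
  let e : E n ≃ₜ E n := Homeomorph.smulOfNeZero t ht.ne'
  have hmap : Measure.map e μHE[d] = (ENNReal.ofReal (t ^ d))⁻¹ • (μHE[d] : Measure (E n)) := by
    ext u hu
    rw [Measure.map_apply e.continuous.measurable hu, Measure.smul_apply, smul_eq_mul]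
    have h1 : u = t • (e ⁻¹' u) := by
      change u = e '' (e ⁻¹' u)
      rw [image_preimage_eq _ e.surjective]
    conv_rhs => rw [h1, Measure.euclideanHausdorffMeasure_smul₀ d ht.ne']
    have h2 : ((‖t‖₊ ^ d : ℝ≥0) : ℝ≥0∞) = ENNReal.ofReal (t ^ d) := by
      rw [ENNReal.ofReal, Real.toNNReal_pow ht.le]
      congr 2
      ext
      simp [abs_of_pos ht, ht.le]
    rw [ENNReal.smul_def, smul_eq_mul, h2, ← mul_assoc,
      ENNReal.inv_mul_cancel (by simpa using pow_pos ht d) ENNReal.ofReal_ne_top, one_mul]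
  have h3 := e.measurableEmbedding.setIntegral_map (μ := μHE[d]) g (t • s)
  have h4 : e ⁻¹' (t • s) = s := by
    change e ⁻¹' (e '' s) = s
    rw [preimage_image_eq _ e.injective]
  rw [hmap, h4, Measure.restrict_smul, integral_smul_measure] at h3
  have h5 : ((ENNReal.ofReal (t ^ d))⁻¹).toReal = (t ^ d)⁻¹ := by
    rw [ENNReal.toReal_inv, ENNReal.toReal_ofReal (by positivity)]
  rw [h5, smul_eq_mul, inv_mul_eq_iff_eq_mul₀ (by positivity)] at h3
  exact h3

theorem frontier_smul (ht : 0 < t) : frontier (t • Ω) = t • frontier Ω :=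
  ((Homeomorph.smulOfNeZero t ht.ne').image_frontier Ω).symm

theorem perimeter_smul (F : E n → ℝ) (ht : 0 < t) :
    perimeter F (t • Ω) = t ^ (n - 1) * perimeter F Ω := by
  rw [perimeter, frontier_smul ht, setIntegral_smul_euclideanHausdorffMeasure ht]
  simp only [outerNormal_smul ht]
  rfl

theorem momentum_smul {p : ℝ} {F : E n → ℝ} (hF : IsFinslerNorm n p F) (hn : 2 ≤ n)
    (ht : 0 < t) : momentum p F (t • Ω) = t ^ (n - 1) * (t ^ p * momentum p F Ω) := by
  rw [momentum, frontier_smul ht, setIntegral_smul_euclideanHausdorffMeasure ht, momentum]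
  simp only [outerNormal_smul ht, polar_smul F ht.le,
    Real.mul_rpow ht.le (hF.polar_nonneg hn _), mul_assoc]
  rw [integral_const_mul]

theorem functional_smul {p : ℝ} {F : E n → ℝ} (hF : IsFinslerNorm n p F) (hn : 2 ≤ n)
    (ht : 0 < t) : functional p F (t • Ω) = functional p F Ω := by
  have hV : volume.real (t • Ω) = t ^ n * volume.real Ω := by
    rw [Measure.real, Measure.addHaar_smul, finrank_euclideanSpace_fin,
      abs_of_pos (pow_pos ht n), ENNReal.toReal_mul, ENNReal.toReal_ofReal (by positivity)]
    rfl
  have hn0 : (n : ℝ) ≠ 0 := by positivity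
  have htp : (t ^ n) ^ (p / n : ℝ) = t ^ p := by
    rw [← Real.rpow_natCast t n, ← Real.rpow_mul ht.le, mul_div_cancel₀ _ hn0]
  rw [functional, functional, perimeter_smul F ht, momentum_smul hF hn ht, hV,
    Real.mul_rpow (by positivity) measureReal_nonneg, htp]
  have h1 : (0 : ℝ) < t ^ (n - 1) := pow_pos ht _
  have h2 : 0 < t ^ p := Real.rpow_pos_of_pos ht p
  rw [show t ^ (n - 1) * perimeter F Ω * (t ^ p * volume.real Ω ^ (p / n : ℝ)) =
    (t ^ (n - 1) * t ^ p) * (perimeter F Ω * volume.real Ω ^ (p / n : ℝ)) by ring,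
    ← mul_assoc, mul_div_mul_left _ _ (by positivity)]

theorem smul_mem_admissible (hΩ : Ω ∈ admissible n) (ht : 0 < t) : t • Ω ∈ admissible n :=
  ⟨hΩ.1.smul_set, hΩ.2.1.smul₀ t, hΩ.2.2.1.smul₀ ht.ne', hΩ.2.2.2.smul t⟩

end Scaling

end AnisotropicMomentum

/-! ### Positivity, finiteness and the lower bound for the functional. -/

namespace AnisotropicMomentum

variable {n : ℕ} {p : ℝ} {F : E n → ℝ} {Ω : Set (E n)}

theorem exists_isGauge_of_mem_admissible (hΩ : Ω ∈ admissible n) :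
    ∃ (r R : ℝ) (N : E n → ℝ) (a : E n), IsGauge r R N ∧ gaugeBody N a = Ω := by
  obtain ⟨⟨a, ha⟩, hb, ho, hc⟩ := hΩ
  obtain ⟨r, hr, hr'⟩ := Metric.isOpen_iff.1 ho a ha
  obtain ⟨R, hR, hR'⟩ := hb.subset_closedBall_lt 0 a
  obtain ⟨N, h1, h2⟩ := IsGauge.exists_of_convex ho hc hr hR hr' hR'
  exact ⟨r, R, N, a, h1, h2⟩

theorem integrableOn_outerNormal (hn : 2 ≤ n) (hΩ : Ω ∈ admissible n) {Φ : E n × E n → ℝ}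
    (hΦ : Continuous Φ) :
    IntegrableOn (fun x => Φ (x, outerNormal Ω x)) (frontier Ω) μHE[n - 1] := by
  obtain ⟨r, R, N, a, h, rfl⟩ := exists_isGauge_of_mem_admissible hΩ
  have hd : finrank ℝ (E n) = n - 1 + 1 := by rw [finrank_euclideanSpace_fin]; omega
  refine (h.integrableOn_frontier (a := a) hd hΦ).congr ?_
  filter_upwards [h.ae_frontier_differentiableAt (a := a) hd] with x hx
  rw [h.outerNormal_eq hx.1 hx.2]

theorem ae_norm_outerNormal (hn : 2 ≤ n) (hΩ : Ω ∈ admissible n) :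
    ∀ᵐ x ∂(μHE[n - 1].restrict (frontier Ω)), ‖outerNormal Ω x‖ = 1 := by
  obtain ⟨r, R, N, a, h, rfl⟩ := exists_isGauge_of_mem_admissible hΩ
  have hd : finrank ℝ (E n) = n - 1 + 1 := by rw [finrank_euclideanSpace_fin]; omega
  filter_upwards [h.ae_frontier_differentiableAt (a := a) hd] with x hx
  exact h.norm_outerNormal hx.1 hx.2

theorem measure_frontier_lt_top (hn : 2 ≤ n) (hΩ : Ω ∈ admissible n) :
    μHE[n - 1] (frontier Ω) < ∞ := by
  obtain ⟨r, R, N, a, h, rfl⟩ := exists_isGauge_of_mem_admissible hΩ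
  exact h.measure_frontier_lt_top (by rw [finrank_euclideanSpace_fin]; omega)

theorem measureReal_frontier_pos (hn : 2 ≤ n) (hΩ : Ω ∈ admissible n) :
    0 < (μHE[n - 1] : Measure (E n)).real (frontier Ω) :=
  ENNReal.toReal_pos (measure_frontier_pos (by rw [finrank_euclideanSpace_fin]; omega)
    hΩ.2.2.1 hΩ.2.1 hΩ.1).ne' (measure_frontier_lt_top hn hΩ).ne

theorem measureReal_pos (hΩ : Ω ∈ admissible n) : 0 < volume.real Ω :=
  ENNReal.toReal_pos (hΩ.2.2.1.measure_pos volume hΩ.1).ne' hΩ.2.1.measure_lt_top.ne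

theorem perimeter_pos (hF : IsFinslerNorm n p F) (hn : 2 ≤ n) (hΩ : Ω ∈ admissible n) :
    0 < perimeter F Ω := by
  obtain ⟨a, ha, hFa⟩ := hF.lower_bound
  have hfin := measure_frontier_lt_top hn hΩ
  have h1 : ∫ _x in frontier Ω, a ∂μHE[n - 1] ≤ perimeter F Ω := by
    refine integral_mono_ae (integrableOn_const hfin.ne)
      (integrableOn_outerNormal hn hΩ (hF.continuous.comp continuous_snd)) ?_
    filter_upwards [ae_norm_outerNormal hn hΩ] with x hx
    have := hFa (outerNormal Ω x)
    rwa [hx, mul_one] at this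
  rw [setIntegral_const, smul_eq_mul] at h1
  exact (mul_pos (measureReal_frontier_pos hn hΩ) ha).trans_le h1

theorem momentum_nonneg (hF : IsFinslerNorm n p F) (hn : 2 ≤ n) : 0 ≤ momentum p F Ω :=
  integral_nonneg fun x => mul_nonneg (Real.rpow_nonneg (hF.polar_nonneg hn x) p) (hF.nonneg _)

theorem functional_nonneg (hF : IsFinslerNorm n p F) (hn : 2 ≤ n) : 0 ≤ functional p F Ω :=
  div_nonneg (momentum_nonneg hF hn) (mul_nonneg (integral_nonneg fun _ => hF.nonneg _)
    (Real.rpow_nonneg measureReal_nonneg _))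

/-- The functional controls the ratio of the circumradius about the origin to the volume. -/
theorem exists_mul_norm_rpow_le_functional_mul (hF : IsFinslerNorm n p F) (hn : 2 ≤ n)
    (hp : 0 < p) : ∃ c : ℝ, 0 < c ∧ ∀ Ω ∈ admissible n, ∀ q ∈ Ω,
      c * ‖q‖ ^ p ≤ functional p F Ω * volume.real Ω ^ (p / n : ℝ) := by
  obtain ⟨a, ha, hFa⟩ := hF.lower_bound
  obtain ⟨b, hb, hFb⟩ := hF.exists_le_mul_norm
  have hd : finrank ℝ (E n) = n - 1 + 1 := by rw [finrank_euclideanSpace_fin]; omega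
  obtain ⟨C, hC⟩ := measure_frontier_le_mul_measure_diff_ball hd (by omega)
  -- With `D` the boundary part outside the ball, the momentum is at least `(‖q‖ / (8 * b)) ^ p * a`
  -- times the measure of `D`, and the perimeter at most `b * (C + 1)` times it. Using `C + 1` keeps
  -- the denominator positive.
  refine ⟨(1 / (8 * b)) ^ p * a / (b * (C + 1)), by positivity, fun Ω hΩ q hq => ?_⟩
  have hfin := measure_frontier_lt_top hn hΩ
  set D := frontier Ω \ Metric.ball 0 (‖q‖ / 8) with hD
  have hDm : MeasurableSet D := isClosed_frontier.measurableSet.diff measurableSet_ball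
  have hDfin : μHE[n - 1] D < ∞ := (measure_mono sdiff_subset).trans_lt hfin
  have hHD : (μHE[n - 1] : Measure (E n)).real (frontier Ω) ≤
      (C + 1) * (μHE[n - 1] : Measure (E n)).real D := by
    have h1 := ENNReal.toReal_mono (ENNReal.mul_lt_top ENNReal.coe_lt_top hDfin).ne
      (hC Ω hΩ.2.2.1 hΩ.2.2.2 hΩ.2.1 q hq)
    rw [ENNReal.toReal_mul, ENNReal.coe_toReal] at h1
    refine h1.trans ?_
    have : 0 ≤ (μHE[n - 1] : Measure (E n)).real D := measureReal_nonneg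
    change (C : ℝ) * (μHE[n - 1] : Measure (E n)).real D ≤ _
    linarith
  have hP : perimeter F Ω ≤ (μHE[n - 1] : Measure (E n)).real (frontier Ω) * b := by
    have h1 : perimeter F Ω ≤ ∫ _x in frontier Ω, b ∂μHE[n - 1] := by
      refine integral_mono_ae
        (integrableOn_outerNormal hn hΩ (hF.continuous.comp continuous_snd))
        (integrableOn_const hfin.ne) ?_
      filter_upwards [ae_norm_outerNormal hn hΩ] with x hx
      have := hFb (outerNormal Ω x)
      rwa [hx, mul_one] at this
    rwa [setIntegral_const, smul_eq_mul] at h1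
  have hint := integrableOn_outerNormal hn hΩ (hF.continuous_momentum_integrand hn hp.le)
  have hM : (μHE[n - 1] : Measure (E n)).real D * ((‖q‖ / 8 / b) ^ p * a) ≤ momentum p F Ω := by
    calc _ = ∫ _x in D, (‖q‖ / 8 / b) ^ p * a ∂μHE[n - 1] := by
          rw [setIntegral_const, smul_eq_mul]
      _ ≤ ∫ x in D, polar F x ^ p * F (outerNormal Ω x) ∂μHE[n - 1] := by
          refine integral_mono_ae (integrableOn_const hDfin.ne) (hint.mono_set sdiff_subset) ?_
          filter_upwards [ae_restrict_of_ae_restrict_of_subset sdiff_subset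
            (ae_norm_outerNormal hn hΩ), ae_restrict_mem hDm] with x hx hxD
          have h1 := hFa (outerNormal Ω x)
          rw [hx, mul_one] at h1
          have h2 : ‖q‖ / 8 ≤ ‖x‖ := by
            have := hxD.2
            rwa [mem_ball_zero_iff, not_lt] at this
          have h3 : ‖q‖ / 8 / b ≤ polar F x :=
            le_trans (by gcongr) (hF.le_polar hn hb hFb x)
          have := hF.polar_nonneg hn x
          gcongr
      _ ≤ momentum p F Ω := by
          refine setIntegral_mono_set hint ?_ sdiff_subset.eventuallyLE
          exact Filter.Eventually.of_forall fun x =>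
            mul_nonneg (Real.rpow_nonneg (hF.polar_nonneg hn x) p) (hF.nonneg _)
  have hPpos := perimeter_pos hF hn hΩ
  have hV : 0 < volume.real Ω ^ (p / n : ℝ) := Real.rpow_pos_of_pos (measureReal_pos hΩ) _
  have hfun : functional p F Ω * volume.real Ω ^ (p / n : ℝ) = momentum p F Ω / perimeter F Ω := by
    rw [functional]
    field_simp
  rw [hfun, le_div_iff₀ hPpos]
  have hq8 : (‖q‖ / 8 / b) ^ p = (1 / (8 * b)) ^ p * ‖q‖ ^ p := by
    rw [← Real.mul_rpow (by positivity) (norm_nonneg q)]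
    congr 1
    field_simp
  rw [hq8] at hM
  have hq0 : 0 ≤ ‖q‖ ^ p := by positivity
  refine le_trans ?_ hM
  calc (1 / (8 * b)) ^ p * a / (b * (C + 1)) * ‖q‖ ^ p * perimeter F Ω
      ≤ (1 / (8 * b)) ^ p * a / (b * (C + 1)) * ‖q‖ ^ p *
        ((C + 1) * (μHE[n - 1] : Measure (E n)).real D * b) := by
        refine mul_le_mul_of_nonneg_left (hP.trans ?_) (by positivity)
        gcongr
    _ = _ := by field_simp

end AnisotropicMomentum

/-! ### Inradius of a convex set of given volume in the unit ball. -/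

section Inradius

variable {n : ℕ}

theorem exists_orthonormalBasis_apply_eq {ν : EuclideanSpace ℝ (Fin n)} (hν : ‖ν‖ = 1)
    (i : Fin n) : ∃ b : OrthonormalBasis (Fin n) ℝ (EuclideanSpace ℝ (Fin n)), b i = ν := by
  let b := EuclideanSpace.basisFun (Fin n) ℝ
  refine ⟨b.map (ℝ ∙ (b i - ν))ᗮ.reflection, ?_⟩
  rw [b.map_apply]
  exact Submodule.reflection_sub (by rw [b.norm_eq_one, hν])

/-- In an orthonormal basis containing `ν` the set lies in a box with one side `2 * s` and all
others 2. -/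
theorem volume_slab_inter_closedBall_le (hn : 0 < n) {ν : EuclideanSpace ℝ (Fin n)}
    (hν : ‖ν‖ = 1) (β : ℝ) {s : ℝ} (hs : 0 ≤ s) :
    volume.real (Metric.closedBall (0 : EuclideanSpace ℝ (Fin n)) 1 ∩
      {y | |inner ℝ y ν - β| ≤ s}) ≤ 2 ^ n * s := by
  obtain ⟨b, hb⟩ := exists_orthonormalBasis_apply_eq hν ⟨0, hn⟩
  set i₀ : Fin n := ⟨0, hn⟩
  let c : Fin n → ℝ := fun i => if i = i₀ then β else 0
  let w : Fin n → ℝ := fun i => if i = i₀ then s else 1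
  have hmp : MeasurePreserving (fun y => WithLp.ofLp (b.repr y)) volume volume :=
    (PiLp.volume_preserving_ofLp (Fin n)).comp b.measurePreserving_repr
  have hw : ∀ i, 0 ≤ w i := fun i => by
    simp only [w]; split_ifs <;> positivity
  have hsub : Metric.closedBall (0 : EuclideanSpace ℝ (Fin n)) 1 ∩ {y | |inner ℝ y ν - β| ≤ s} ⊆
      (fun y => WithLp.ofLp (b.repr y)) ⁻¹' Icc (c - w) (c + w) := by
    rintro y ⟨hy, hyν⟩
    have h1 : ∀ i, |b.repr y i - c i| ≤ w i := by
      intro i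
      rw [b.repr_apply_apply]
      by_cases hi : i = i₀
      · simp only [c, w, hi, if_true, hb]
        rw [real_inner_comm]
        exact hyν
      · simp only [c, w, hi, if_false, sub_zero]
        refine (abs_real_inner_le_norm _ _).trans ?_
        rw [b.norm_eq_one, one_mul]
        exact mem_closedBall_zero_iff.1 hy
    constructor
    · intro i
      have := (abs_le.1 (h1 i)).1
      simp only [Pi.sub_apply]
      linarith
    · intro i
      have := (abs_le.1 (h1 i)).2
      simp only [Pi.add_apply]
      linarith
  have hvol : volume (Icc (c - w) (c + w)) = ENNReal.ofReal (2 ^ n * s) := by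
    rw [Real.volume_Icc_pi, ← ENNReal.ofReal_prod_of_nonneg]
    · congr 1
      have h2 : ∀ i, (c + w) i - (c - w) i = 2 * w i := fun i => by
        simp only [Pi.add_apply, Pi.sub_apply]; ring
      simp only [h2, Finset.prod_mul_distrib, w, Finset.prod_ite_eq', Finset.prod_const]
      simp
    · intro i _
      have := hw i
      simp only [Pi.add_apply, Pi.sub_apply]
      linarith
  rw [Measure.real]
  refine ENNReal.toReal_le_of_le_ofReal (by positivity) ?_
  rw [← hvol, ← hmp.measure_preimage measurableSet_Icc.nullMeasurableSet]
  exact measure_mono hsub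

/-- A convex subset of the unit ball with volume bounded below has inradius bounded below. -/
theorem exists_ball_subset_of_le_volume (hn : 0 < n) {v : ℝ} (hv : 0 < v) :
    ∃ r : ℝ, 0 < r ∧ ∀ Ω : Set (EuclideanSpace ℝ (Fin n)), IsOpen Ω → Convex ℝ Ω →
      Ω ⊆ Metric.closedBall 0 1 → v ≤ volume.real Ω →
      ∃ x ∈ Metric.closedBall 0 1, Metric.ball x r ⊆ Ω := by
  -- Chosen so that a slab of half-width `s` has volume at most `2 ^ n * s = v / 4` in the unit
  -- ball.
  set s : ℝ := v / (4 * 2 ^ n) with hs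
  have hs0 : 0 < s := by positivity
  refine ⟨s / 8, by positivity, fun Ω ho hc hΩ hvol => ?_⟩
  have hfin : volume Ω < ∞ := (measure_mono hΩ).trans_lt measure_closedBall_lt_top
  have : IsFiniteMeasure (volume.restrict Ω) := ⟨by simpa using hfin⟩
  set V := volume.real Ω with hV
  have hV0 : 0 < V := hv.trans_le hvol
  have hmem : ∀ᵐ y ∂volume.restrict Ω, ‖y‖ ≤ 1 := by
    filter_upwards [ae_restrict_mem ho.measurableSet] with y hy
    exact mem_closedBall_zero_iff.1 (hΩ hy)
  have hint : IntegrableOn (fun y : EuclideanSpace ℝ (Fin n) => y) Ω :=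
    IntegrableOn.of_bound hfin aestronglyMeasurable_id 1 hmem
  -- The centre of the ball is the centroid of `Ω`.
  set c := V⁻¹ • ∫ y in Ω, y with hc'
  refine ⟨c, ?_, ?_⟩
  · rw [mem_closedBall_zero_iff, hc', norm_smul, norm_inv, Real.norm_of_nonneg hV0.le,
      inv_mul_le_iff₀ hV0]
    simpa [mul_comm] using norm_setIntegral_le_of_norm_le_const_ae' hfin
      ((ae_restrict_iff' ho.measurableSet).1 hmem)
  -- Otherwise a supporting hyperplane passes within `s / 8` of the centroid. Then `φ ≤ s / 8` on
  -- `Ω` and `φ` has mean zero, so the integral of `|φ|` is at most `s / 4 * V`. By Markov `|φ| ≥ s`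
  -- on at most a quarter of `Ω`, while the slab `|φ| ≤ s` has volume at most `v / 4 ≤ V / 4`.
  by_contra hcon
  obtain ⟨x, hx, hxΩ⟩ := not_subset.1 hcon
  have hne : Ω.Nonempty := by
    rw [nonempty_iff_ne_empty]
    rintro rfl
    simp [hV] at hV0
  obtain ⟨ν, hν, hsep⟩ := exists_supporting_unit_vector ho hc hxΩ hne
  set φ : EuclideanSpace ℝ (Fin n) → ℝ := fun y => inner ℝ y ν - inner ℝ c ν with hφ
  have hφint : IntegrableOn φ Ω := by
    refine Integrable.sub ?_ (integrable_const _)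
    simpa [real_inner_comm] using (innerSL ℝ ν).integrable_comp hint
  have hφ0 : ∫ y in Ω, φ y = 0 := by
    rw [hφ, integral_sub (by simpa [real_inner_comm] using (innerSL ℝ ν).integrable_comp hint)
      (integrable_const _), setIntegral_const]
    have h1 : ∫ y in Ω, inner ℝ y ν = inner ℝ (∫ y in Ω, y) ν := by
      have := (innerSL ℝ ν).integral_comp_comm hint
      simpa [real_inner_comm] using this
    rw [h1, hc', inner_smul_left, conj_trivial, smul_eq_mul, ← hV, mul_inv_cancel_left₀ hV0.ne',
      sub_self]
  have hφle : ∀ y ∈ Ω, |φ y| ≤ s / 4 - φ y := by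
    intro y hy
    have h1 := hsep y hy
    have h2 : inner ℝ (x - c) ν ≤ s / 8 := by
      refine (real_inner_le_norm _ _).trans ?_
      rw [hν, mul_one]
      exact (mem_ball_iff_norm.1 hx).le
    rw [inner_sub_left] at h1 h2
    have h3 : φ y ≤ s / 8 := by simp only [hφ]; linarith
    rcases abs_cases (φ y) with ⟨h, -⟩ | ⟨h, -⟩ <;> rw [h] <;> linarith
  have habs : ∫ y in Ω, |φ y| ≤ s / 4 * V := by
    calc ∫ y in Ω, |φ y| ≤ ∫ y in Ω, (s / 4 - φ y) :=
          setIntegral_mono_on hφint.abs ((integrable_const _).sub hφint)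
            ho.measurableSet hφle
      _ = s / 4 * V := by
          rw [integral_sub (integrable_const _) hφint, hφ0, setIntegral_const, smul_eq_mul,
            sub_zero, mul_comm]
  have hmarkov : s * (volume.restrict Ω).real {y | s ≤ |φ y|} ≤ ∫ y in Ω, |φ y| :=
    mul_meas_ge_le_integral_of_nonneg (Filter.Eventually.of_forall fun y => abs_nonneg _)
      hφint.abs s
  have h1 : (volume.restrict Ω).real {y | s ≤ |φ y|} ≤ V / 4 := by
    have : s * (volume.restrict Ω).real {y | s ≤ |φ y|} ≤ s * (V / 4) := by linarith
    exact le_of_mul_le_mul_left this hs0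
  have h2 : (volume.restrict Ω).real {y | |φ y| ≤ s} ≤ v / 4 := by
    have h3 := volume_slab_inter_closedBall_le hn hν (inner ℝ c ν) hs0.le
    have h4 : (2 : ℝ) ^ n * s = v / 4 := by rw [hs]; field_simp
    rw [h4] at h3
    refine le_trans ?_ h3
    have hcφ : Continuous φ := by fun_prop
    rw [measureReal_restrict_apply (isClosed_le hcφ.abs continuous_const).measurableSet,
      inter_comm]
    refine measureReal_mono (inter_subset_inter_left _ hΩ) ?_
    exact ((measure_mono inter_subset_left).trans_lt measure_closedBall_lt_top).ne
  have h3 : V ≤ (volume.restrict Ω).real {y | s ≤ |φ y|} +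
      (volume.restrict Ω).real {y | |φ y| ≤ s} := by
    refine le_trans (le_of_eq ?_) (measureReal_union_le _ _)
    have hu : {y | s ≤ |φ y|} ∪ {y | |φ y| ≤ s} = univ :=
      eq_univ_of_forall fun y => le_total s |φ y|
    rw [hu, measureReal_restrict_apply MeasurableSet.univ, univ_inter]
  linarith

end Inradius

/-! ### Normalization, continuity of the functional and existence of a minimizer. -/

namespace AnisotropicMomentum

variable {n : ℕ} {p : ℝ} {F : E n → ℝ} {Ω : Set (E n)}

theorem exists_mem_ne_zero (hn : 2 ≤ n) (hΩ : Ω ∈ admissible n) : ∃ x ∈ Ω, x ≠ 0 := by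
  by_contra! h
  have h1 : Ω ⊆ {0} := fun x hx => h x hx
  have h2 : volume Ω ≤ volume ({0} : Set (E n)) := measure_mono h1
  have : Nonempty (Fin n) := ⟨⟨0, by omega⟩⟩
  rw [measure_singleton] at h2
  exact (hΩ.2.2.1.measure_pos volume hΩ.1).not_ge h2

/-- Every competitor can be rescaled to have circumradius about the origin comparable to one. -/
theorem exists_normalized (hF : IsFinslerNorm n p F) (hn : 2 ≤ n) (hΩ : Ω ∈ admissible n) :
    ∃ Ω' ∈ admissible n, functional p F Ω' = functional p F Ω ∧ Ω' ⊆ Metric.closedBall 0 1 ∧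
      ∃ q ∈ Ω', 1 / 2 ≤ ‖q‖ := by
  obtain ⟨x, hx, hx0⟩ := exists_mem_ne_zero hn hΩ
  obtain ⟨C, hC⟩ := hΩ.2.1.exists_norm_le
  have hbdd : BddAbove (norm '' Ω) := ⟨C, by rintro _ ⟨y, hy, rfl⟩; exact hC y hy⟩
  set S := sSup (norm '' Ω) with hS
  have hSle : ∀ y ∈ Ω, ‖y‖ ≤ S := fun y hy => le_csSup hbdd (mem_image_of_mem _ hy)
  have hS0 : 0 < S := (norm_pos_iff.2 hx0).trans_le (hSle x hx)
  -- The supremum is not attained on an open set, so a point reaching half of it is used.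
  obtain ⟨_, ⟨q, hq, rfl⟩, hqS⟩ := exists_lt_of_lt_csSup (hΩ.1.image norm) (half_lt_self hS0)
  refine ⟨S⁻¹ • Ω, smul_mem_admissible hΩ (inv_pos.2 hS0),
    functional_smul hF hn (inv_pos.2 hS0), ?_, S⁻¹ • q, smul_mem_smul_set hq, ?_⟩
  · rintro _ ⟨y, hy, rfl⟩
    rw [mem_closedBall_zero_iff, norm_smul, norm_inv, Real.norm_of_nonneg hS0.le,
      inv_mul_le_iff₀ hS0, mul_one]
    exact hSle y hy
  · rw [norm_smul, norm_inv, Real.norm_of_nonneg hS0.le, le_inv_mul_iff₀ hS0]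
    linarith

/-- The functional is continuous along converging sequences of gauges and centres. -/
theorem tendsto_functional (hF : IsFinslerNorm n p F) (hn : 2 ≤ n) (hp : 0 ≤ p) {r R : ℝ}
    {N : E n → ℝ} {M : ℕ → E n → ℝ} {a : E n} {b : ℕ → E n} (h : ∀ k, IsGauge r R (M k))
    (hN : IsGauge r R N) (hM : ∀ y, Filter.Tendsto (fun k => M k y) Filter.atTop (𝓝 (N y)))
    (hb : Filter.Tendsto b Filter.atTop (𝓝 a)) :
    Filter.Tendsto (fun k => functional p F (gaugeBody (M k) (b k))) Filter.atTop
      (𝓝 (functional p F (gaugeBody N a))) := by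
  have hd : n = n - 1 + 1 := by omega
  have hd' : finrank ℝ (E n) = n - 1 + 1 := by rw [finrank_euclideanSpace_fin]; omega
  have key : ∀ Φ : E n × E n → ℝ, Continuous Φ → Filter.Tendsto
      (fun k => ∫ x in frontier (gaugeBody (M k) (b k)),
        Φ (x, outerNormal (gaugeBody (M k) (b k)) x) ∂μHE[n - 1]) Filter.atTop
      (𝓝 (∫ x in frontier (gaugeBody N a), Φ (x, outerNormal (gaugeBody N a) x) ∂μHE[n - 1])) := by
    intro Φ hΦ
    rw [hN.setIntegral_outerNormal hd]
    simp only [fun k => (h k).setIntegral_outerNormal hd (a := b k) Φ]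
    exact IsGauge.tendsto_setIntegral_frontier hd' h hN hM hb hΦ
  have hΩ := hN.mem_admissible (a := a)
  have hV := measureReal_pos hΩ
  refine (key _ (hF.continuous_momentum_integrand hn hp)).div
    ((key _ (hF.continuous.comp continuous_snd)).mul
      ((IsGauge.tendsto_volume h hN hM hb).rpow_const (Or.inl hV.ne'))) ?_
  exact (mul_pos (perimeter_pos hF hn hΩ) (Real.rpow_pos_of_pos hV _)).ne'

end AnisotropicMomentum

open AnisotropicMomentum

theorem mainTheorem5 (n : ℕ) (hn : 2 ≤ n) (p : ℝ) (hp : 1 < p)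
    (F : AnisotropicMomentum.E n → ℝ) (hF : AnisotropicMomentum.IsFinslerNorm n p F) :
    ∃ Ω ∈ AnisotropicMomentum.admissible n, ∀ Ω' ∈ AnisotropicMomentum.admissible n,
      AnisotropicMomentum.functional p F Ω ≤ AnisotropicMomentum.functional p F Ω' := by
  have hp0 : 0 < p := by linarith
  have hn0 : (0 : ℝ) < n := by exact_mod_cast (by omega : 0 < n)
  set A := functional p F '' admissible n with hA
  have hne : A.Nonempty := ⟨_, Metric.ball 0 1, ⟨⟨0, Metric.mem_ball_self one_pos⟩,
    Metric.isBounded_ball, Metric.isOpen_ball, convex_ball 0 1⟩, rfl⟩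
  have hbdd : BddBelow A := ⟨0, by rintro _ ⟨Ω, -, rfl⟩; exact functional_nonneg hF hn⟩
  set m := sInf A with hm
  have hm0 : 0 ≤ m := le_csInf hne (by rintro _ ⟨Ω, -, rfl⟩; exact functional_nonneg hF hn)
  obtain ⟨c, hc, hcle⟩ := exists_mul_norm_rpow_le_functional_mul hF hn hp0
  -- The volume threshold solves `c * (1 / 2) ^ p = (m + 1) * V ^ (p / n)`; normalized competitors
  -- with functional at most `m + 1` have at least this volume.
  obtain ⟨r, hr, hball⟩ := exists_ball_subset_of_le_volume (n := n) (by omega)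
    (v := (c * (1 / 2) ^ p / (m + 1)) ^ (n / p : ℝ)) (by positivity)
  -- Outer radius 2: both the body and the centre `x` lie in the closed unit ball.
  have hseq : ∀ k : ℕ, ∃ (x : E n) (N : E n → ℝ), x ∈ Metric.closedBall 0 1 ∧ IsGauge r 2 N ∧
      functional p F (gaugeBody N x) ≤ m + 1 / (k + 1) := by
    intro k
    have hk : (0 : ℝ) < 1 / (k + 1) := by positivity
    obtain ⟨_, ⟨Ω₀, hΩ₀, rfl⟩, hlt⟩ := exists_lt_of_csInf_lt hne (lt_add_of_pos_right m hk)
    obtain ⟨Ω, hΩ, hfun, hsub, q, hq, hq2⟩ := exists_normalized hF hn hΩ₀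
    have hle : functional p F Ω ≤ m + 1 := by
      rw [hfun]
      refine hlt.le.trans ?_
      gcongr
      rw [div_le_one (by positivity)]
      linarith [(Nat.cast_nonneg k : (0 : ℝ) ≤ k)]
    have hV := measureReal_pos hΩ
    have hvol : (c * (1 / 2) ^ p / (m + 1)) ^ (n / p : ℝ) ≤ volume.real Ω := by
      have h1 : c * (1 / 2) ^ p / (m + 1) ≤ volume.real Ω ^ (p / n : ℝ) := by
        rw [div_le_iff₀' (by positivity)]
        calc c * (1 / 2) ^ p ≤ c * ‖q‖ ^ p := by gcongr
          _ ≤ _ := hcle Ω hΩ q hq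
          _ ≤ _ := by gcongr
      calc _ ≤ (volume.real Ω ^ (p / n : ℝ)) ^ (n / p : ℝ) := by gcongr
        _ = volume.real Ω := by
          rw [← Real.rpow_mul hV.le, div_mul_div_cancel₀ hn0.ne', div_self hp0.ne', Real.rpow_one]
    obtain ⟨x, hx, hxr⟩ := hball Ω hΩ.2.2.1 hΩ.2.2.2 hsub hvol
    have hx2 : Ω ⊆ Metric.closedBall x 2 := hsub.trans <|
      Metric.closedBall_subset_closedBall' <| by
        rw [mem_closedBall_zero_iff] at hx
        rw [dist_zero_left]
        linarith
    obtain ⟨N, hN, hNΩ⟩ := IsGauge.exists_of_convex hΩ.2.2.1 hΩ.2.2.2 hr two_pos hxr hx2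
    exact ⟨x, N, hx, hN, by rw [hNΩ, hfun]; exact hlt.le⟩
  choose x N hx hN hfun using hseq
  -- The functional is not translation invariant, so the centres are followed along with the gauges.
  obtain ⟨a, -, φ, hφ, ha⟩ := (isCompact_closedBall (0 : E n) 1).tendsto_subseq hx
  obtain ⟨ψ, hψ, N', hN', hlim⟩ := IsGauge.exists_subseq_tendsto fun k => hN (φ k)
  have hconv := tendsto_functional hF hn hp0.le (fun k => hN (φ (ψ k))) hN' hlim
    (ha.comp hψ.tendsto_atTop)
  have hle : functional p F (gaugeBody N' a) ≤ m := by
    have h1 : Filter.Tendsto (fun k : ℕ => m + 1 / ((k : ℝ) + 1)) Filter.atTop (𝓝 (m + 0)) :=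
      tendsto_const_nhds.add tendsto_one_div_add_atTop_nhds_zero_nat
    rw [add_zero] at h1
    exact le_of_tendsto_of_tendsto' hconv
      (h1.comp (hφ.tendsto_atTop.comp hψ.tendsto_atTop)) fun k => hfun (φ (ψ k))
  exact ⟨gaugeBody N' a, hN'.mem_admissible, fun Ω' hΩ' =>
    hle.trans (csInf_le hbdd (mem_image_of_mem _ hΩ'))⟩
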